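/- For a complex Banach space $X$ with open unit ball $B_X$, let $\mathcal{A}_u(B_X)$ be the Banach algebra of all uniformly continuous holomorphic functions $f:B_X\to\mathbb{C}$, with the norm $\|f\|=\sup_{x\in B_X}|f(x)|$; each such $f$ extends continuously to $\overline{B}_X$, and $f(x)$ for $x\in\overline{B}_X$ denotes the value of this extension. Let $\mathcal{M}(\mathcal{A}_u(B_X))$ be the set of all nonzero multiplicative continuous linear functionals on $\mathcal{A}_u(B_X)$, with the $w^*$-topology. For $x\in\overline{B}_X$ let $\delta_x(f)=f(x)$. For $z\in\overline B_X$, the fiber over $z$ is $\mathcal{M}_z=\{\varphi\in\mathcal{M}(\mathcal{A}_u(B_X)) : \varphi(x'|_{B_X})=x'(z)\text{ for all }x'\in X'\}$. The Gleason part of $\varphi$ is $\mathcal{GP}(\varphi)=\{\psi\in\mathcal{M}(\mathcal{A}_u(B_X)) : \|\varphi-\psi\|<2\}$, where $\|\cdot\|$ is the norm of $\mathcal{A}_u(B_X)'$; the Gleason parts form a partition of the spectrum. Theorem. Let $1<p<\infty$, let $z=(z(i))_{i\ge1}\in\ell_p$ (complex sequences) with $\|z\|<1$, and put $s=(1-\|z\|^p)^{1/p}$.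 For $n\in\mathbb{N}$ let $\pi_n(z)=(z(1),\dots,z(n),0,0,\dots)$, let $e_n$ be the $n$-th canonical vector, and let $W$ be the set of all $w^*$-accumulation points in $\mathcal{M}(\mathcal{A}_u(B_{\ell_p}))$ of the sequence $(\delta_{\pi_n(z)+s e_{n+1}})_{n}$. Then: 1. $W$ has cardinality $2^{\mathfrak{c}}$, where $\mathfrak c$ is the cardinality of the continuum, and $W\subset\mathcal{M}_z$. 2. Distinct points of $W$ lie in distinct (hence disjoint) Gleason parts. 3. $\mathcal{GP}(\varphi)\subset\mathcal{M}_z$ for every $\varphi\in W$. 4. The set of Gleason parts of $\mathcal{M}(\mathcal{A}_u(B_{\ell_p}))$ that are entirely contained in $\mathcal{M}_z$ has cardinality $2^{\mathfrak{c}}$. -/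

import Mathlib

open Filter Topology Metric Cardinal
open scoped ENNReal BoundedContinuousFunction

noncomputable section

namespace HolSpectrum

section General

variable (X : Type*) [NormedAddCommGroup X] [NormedSpace ℂ X]

/-- The algebra `𝒜_u(B_X)` of uniformly continuous holomorphic functions on the open unit ball
`B_X`, with pointwise operations and the supremum norm. It is realized inside the bounded
continuous functions on `B_X`: a uniformly continuous function on `B_X` is automatically bounded.
Holomorphic means having a power series expansion (in continuous homogeneous polynomials),
uniformly convergent near each point of `B_X`, that is, analytic in the sense of `AnalyticAt`;
`F` is only a way to view `f` as a function defined on all of `X`. -/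
def Au : Subalgebra ℂ (ball (0 : X) 1 →ᵇ ℂ) where
  carrier := {f | UniformContinuous f ∧
    ∃ F : X → ℂ, AnalyticOnNhd ℂ F (ball 0 1) ∧ ∀ x : ball (0 : X) 1, F x = f x}
  mul_mem' := by
    rintro f g ⟨hf, F, hF, hFf⟩ ⟨hg, G, hG, hGg⟩
    refine ⟨?_, F * G, hF.mul hG, fun x => by simp [hFf, hGg]⟩
    rw [Metric.uniformContinuous_iff] at hf hg ⊢
    intro ε hε
    have hA : 0 < ‖f‖ + ‖g‖ + 1 := by positivity
    obtain ⟨d₁, hd₁, h₁⟩ := hf (ε / (2 * (‖f‖ + ‖g‖ + 1))) (by positivity)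
    obtain ⟨d₂, hd₂, h₂⟩ := hg (ε / (2 * (‖f‖ + ‖g‖ + 1))) (by positivity)
    refine ⟨min d₁ d₂, lt_min hd₁ hd₂, fun {x y} hxy => ?_⟩
    have e₁ := h₁ (hxy.trans_le (min_le_left _ _))
    have e₂ := h₂ (hxy.trans_le (min_le_right _ _))
    rw [dist_eq_norm] at e₁ e₂ ⊢
    have key : (f * g) x - (f * g) y = f x * (g x - g y) + (f x - f y) * g y := by
      simp only [BoundedContinuousFunction.coe_mul, Pi.mul_apply]; ring
    rw [key]
    have n₁ := f.norm_coe_le_norm x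
    have n₂ := g.norm_coe_le_norm y
    calc ‖f x * (g x - g y) + (f x - f y) * g y‖
        ≤ ‖f x‖ * ‖g x - g y‖ + ‖f x - f y‖ * ‖g y‖ := by
          refine (norm_add_le _ _).trans ?_
          rw [norm_mul, norm_mul]
      _ ≤ ‖f‖ * (ε / (2 * (‖f‖ + ‖g‖ + 1))) + (ε / (2 * (‖f‖ + ‖g‖ + 1))) * ‖g‖ := by
          gcongr
      _ = (‖f‖ + ‖g‖) / (‖f‖ + ‖g‖ + 1) * (ε / 2) := by field_simp
      _ ≤ 1 * (ε / 2) := by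
          gcongr
          rw [div_le_one hA]; linarith
      _ < ε := by linarith
  add_mem' := by
    rintro f g ⟨hf, F, hF, hFf⟩ ⟨hg, G, hG, hGg⟩
    exact ⟨hf.add hg, F + G, hF.add hG, fun x => by simp [hFf, hGg]⟩
  algebraMap_mem' c := ⟨uniformContinuous_const, fun _ => c, fun _ _ => analyticAt_const,
    fun _ => rfl⟩

/-- The spectrum `ℳ(𝒜_u(B_X))`: nonzero multiplicative continuous linear functionals, with the
weak-star topology. -/
abbrev Spectrum : Type _ := WeakDual.characterSpace ℂ (Au X)

variable {X}

/-- The restriction of a continuous linear functional to `B_X`, as an element of `𝒜_u(B_X)`. -/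
def ofDual (x' : StrongDual ℂ X) : Au X :=
  ⟨BoundedContinuousFunction.ofNormedAddCommGroup (fun x : ball (0 : X) 1 => x' x)
      (x'.continuous.comp continuous_subtype_val) ‖x'‖
      (fun x => x'.unit_le_opNorm _ (mem_ball_zero_iff.1 x.2).le),
    x'.uniformContinuous.comp uniformContinuous_subtype_val, x',
    fun _ _ => x'.analyticAt _, fun _ => rfl⟩

/-- The fiber `ℳ_z` over a point `z` of the bidual: the `φ` with `φ|_{X'} = z`. -/
def fiber (z : StrongDual ℂ (StrongDual ℂ X)) : Set (Spectrum X) :=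
  {φ | ∀ x' : StrongDual ℂ X, φ (ofDual x') = z x'}

/-- The Gleason distance: the metric inherited from the dual norm of `𝒜_u(B_X)'`. -/
def gleasonDist (φ ψ : Spectrum X) : ℝ :=
  ‖WeakDual.CharacterSpace.toCLM φ - WeakDual.CharacterSpace.toCLM ψ‖

/-- The Gleason part containing `φ`. -/
def gleasonPart (φ : Spectrum X) : Set (Spectrum X) := {ψ | gleasonDist φ ψ < 2}

variable (X) in
/-- The family of all Gleason parts of the spectrum. -/
def gleasonParts : Set (Set (Spectrum X)) := Set.range gleasonPart

/-- The set of weak-star accumulation points of a net in the spectrum. -/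
def wstarAcc {ι : Type*} [Preorder ι] (φ : ι → Spectrum X) : Set (Spectrum X) :=
  {ψ | MapClusterPt ψ atTop φ}

/-- The continuous extension of `f` to the closed unit ball: the value at `x` is the limit of `f`
along points of `B_X` tending to `x`. -/
def extend (f : Au X) (x : X) : ℂ :=
  limUnder (comap ((↑) : ball (0 : X) 1 → X) (𝓝 x)) (f : ball (0 : X) 1 →ᵇ ℂ)

theorem comap_neBot {x : X} (hx : ‖x‖ ≤ 1) :
    NeBot (comap ((↑) : ball (0 : X) 1 → X) (𝓝 x)) := by
  rw [← mem_closure_iff_comap_neBot, closure_ball (0 : X) one_ne_zero]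
  simpa using hx

theorem tendsto_extend (f : Au X) {x : X} (hx : ‖x‖ ≤ 1) :
    Tendsto (f : ball (0 : X) 1 →ᵇ ℂ) (comap ((↑) : ball (0 : X) 1 → X) (𝓝 x))
      (𝓝 (extend f x)) := by
  have := comap_neBot hx
  refine tendsto_nhds_limUnder ?_
  have hc : Cauchy (comap ((↑) : ball (0 : X) 1 → X) (𝓝 x)) := cauchy_nhds.comap le_rfl
  exact cauchy_map_iff_exists_tendsto.1 (hc.map f.2.1)

theorem extend_eq_of_tendsto (f : Au X) {x : X} (hx : ‖x‖ ≤ 1) {c : ℂ}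
    (h : Tendsto (f : ball (0 : X) 1 →ᵇ ℂ) (comap ((↑) : ball (0 : X) 1 → X) (𝓝 x)) (𝓝 c)) :
    extend f x = c :=
  haveI := comap_neBot hx
  tendsto_nhds_unique (tendsto_extend f hx) h

theorem extend_coe (f : Au X) (x : ball (0 : X) 1) :
    extend f x = (f : ball (0 : X) 1 →ᵇ ℂ) x := by
  refine extend_eq_of_tendsto f (mem_ball_zero_iff.1 x.2).le ?_
  rw [← nhds_subtype_eq_comap]
  exact (f : ball (0 : X) 1 →ᵇ ℂ).continuous.tendsto x

/-- The evaluation homomorphism `δ_x` at a point `x` of the closed unit ball. -/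
def delta (x : closedBall (0 : X) 1) : Spectrum X :=
  have hx : ‖(x : X)‖ ≤ 1 := mem_closedBall_zero_iff.1 x.2
  let L : Au X →ₗ[ℂ] ℂ :=
    { toFun := fun f => extend f x
      map_add' := fun f g => extend_eq_of_tendsto (f + g) hx
        ((tendsto_extend f hx).add (tendsto_extend g hx))
      map_smul' := fun c f => extend_eq_of_tendsto (c • f) hx
        ((tendsto_extend f hx).const_mul c) }
  ⟨(L.mkContinuous 1 fun f => by
      have := comap_neBot hx
      rw [one_mul]
      exact le_of_tendsto (tendsto_extend f hx).norm
        (Eventually.of_forall fun y => (f : ball (0 : X) 1 →ᵇ ℂ).norm_coe_le_norm y)),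
    fun h0 => by
      have h1 : extend (1 : Au X) (x : X) = 1 :=
        extend_eq_of_tendsto 1 hx (tendsto_const_nhds (x := (1 : ℂ)))
      have h2 : extend (1 : Au X) (x : X) = 0 := DFunLike.congr_fun h0 (1 : Au X)
      exact one_ne_zero (h1.symm.trans h2),
    fun f g => extend_eq_of_tendsto (f * g) hx ((tendsto_extend f hx).mul (tendsto_extend g hx))⟩

theorem delta_apply (x : closedBall (0 : X) 1) (f : Au X) : delta x f = extend f x := rfl

end General

section EllP

variable {p : ℝ≥0∞}

/-- The complex sequence space `ℓ_p` (coordinates are indexed from `0`). -/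
abbrev EllP (p : ℝ≥0∞) := lp (fun _ : ℕ => ℂ) p

/-- The truncation of `z` to its first `n` coordinates. -/
def truncation (z : EllP p) (n : ℕ) : EllP p := ∑ i ∈ Finset.range n, lp.single p i (z i)

theorem truncation_apply (z : EllP p) (n i : ℕ) :
    truncation z n i = if i < n then z i else 0 := by
  have h : truncation z n i = ∑ j ∈ Finset.range n, (lp.single p j (z j) : EllP p) i := by
    rw [truncation, lp.coeFn_sum, Finset.sum_apply]
  rw [h]
  simp [Pi.single_apply]

/-- The number `s = (1 - ‖z‖ ^ p) ^ (1 / p)`. -/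
def gap (z : EllP p) : ℝ := (1 - ‖z‖ ^ p.toReal) ^ (1 / p.toReal)

/-- The first `n` coordinates of `z`, followed by the entry `s` in the next coordinate,
and then zeros. -/
def testPoint (z : EllP p) (n : ℕ) : EllP p :=
  truncation z n + lp.single p n (gap z : ℂ)

theorem testPoint_apply (z : EllP p) (n i : ℕ) :
    testPoint z n i = if i < n then z i else if i = n then (gap z : ℂ) else 0 := by
  have : testPoint z n i = truncation z n i + (lp.single p n (gap z : ℂ) : EllP p) i := rfl
  rw [this, truncation_apply, lp.single_apply]
  rcases lt_trichotomy i n with h | h | h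
  · simp [h, h.ne]
  · simp [h]
  · simp [h.not_gt, h.ne']

theorem norm_testPoint_le [Fact (1 ≤ p)] (hp : p ≠ ∞) (z : EllP p) (hz : ‖z‖ ≤ 1) (n : ℕ) :
    ‖testPoint z n‖ ≤ 1 := by
  have hp0 : 0 < p.toReal :=
    ENNReal.toReal_pos (zero_lt_one.trans_le (Fact.out : 1 ≤ p)).ne' hp
  have h0 : 0 ≤ 1 - ‖z‖ ^ p.toReal :=
    sub_nonneg.2 (Real.rpow_le_one (norm_nonneg _) hz hp0.le)
  have hs : ‖(gap z : ℂ)‖ ^ p.toReal = 1 - ‖z‖ ^ p.toReal := by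
    have : 0 ≤ gap z := Real.rpow_nonneg h0 _
    rw [Complex.norm_real, Real.norm_of_nonneg this, gap, ← Real.rpow_mul h0,
      one_div_mul_cancel hp0.ne', Real.rpow_one]
  have hsum : ‖testPoint z n‖ ^ p.toReal
      = ∑ i ∈ Finset.range n, ‖z i‖ ^ p.toReal + (1 - ‖z‖ ^ p.toReal) := by
    rw [lp.norm_rpow_eq_tsum hp0, tsum_eq_sum (s := Finset.range (n + 1)),
      Finset.sum_range_succ]
    · congr 1
      · refine Finset.sum_congr rfl fun i hi => ?_
        rw [testPoint_apply, if_pos (Finset.mem_range.1 hi)]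
      · rw [testPoint_apply, if_neg (lt_irrefl n), if_pos rfl, hs]
    · intro i hi
      have hi' : n < i := by simpa [Nat.succ_le_iff] using hi
      rw [testPoint_apply, if_neg hi'.not_gt, if_neg hi'.ne', norm_zero, Real.zero_rpow hp0.ne']
  have hle : ‖testPoint z n‖ ^ p.toReal ≤ 1 := by
    have := lp.sum_rpow_le_norm_rpow hp0 z (Finset.range n)
    rw [hsum]; linarith
  by_contra! h
  exact absurd hle (Real.one_lt_rpow h hp0).not_ge

/-- The sequence of evaluations at the points `testPoint z n` of the closed unit ball. -/
def deltaSeq [Fact (1 ≤ p)] (hp : p ≠ ∞) (z : EllP p) (hz : ‖z‖ ≤ 1) (n : ℕ) :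
    Spectrum (EllP p) :=
  delta ⟨testPoint z n, mem_closedBall_zero_iff.2 (norm_testPoint_le hp z hz n)⟩

end EllP

end HolSpectrum

end

/-! Everything rests on explicit peak functions `peakAu`. For an integer `N ≥ p`, a bounded
coefficient sequence `ε` and `J y = |y|^(p-2) conj y`, take `f_M(x) = C_M · exp(κ p ∑_{i<M} J(y_i)
x_i) · ∑_{n≥M} ε_n x_n^N`, with `κ = N / (p s^p)`. The power sum is controlled by the mass of `x`
beyond `M`, the exponential by the mass before `M` through Young's inequality; since the total mass
is at most `1`, `C_M` can be chosen with `‖f_M‖ ≤ 1` for every `y` (`norm_peakAu_le`). For `y = z`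
the bound is asymptotically attained at points of `W`: if `φ` is the limit along a free ultrafilter
on which `ε` is eventually `e`, then `φ(f_M) → e` (`tendsto_apply_peakAu`).

If `‖φ - ψ‖ < 2`, functions of norm at most one that tend to `1` at `φ` also tend to `1` at `ψ`
(`tendsto_one_of_mem_gleasonPart`). This has two consequences. Taking `ε = 1` on `A` and `-1` off
`A` puts limits along ultrafilters separated by `A` in disjoint parts. Taking `ε = 1`, any `ψ` in
the part of `φ` satisfies `ψ(f_M) → 1`; replacing `y_j = z_j` by the `j`-th coordinate of `ψ`
multiplies `|ψ(f_M)|` by the exponential of a Young deficit without leaving the unit ball, so the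
deficit vanishes and that coordinate is `z_j`. Coordinate functionals span a dense subspace of the
dual, whence `ψ ∈ ℳ_z`.

An independent family on `ℕ` supplies `2^𝔠` ultrafilters that are pairwise separated in this way;
separability of `ℓ_p` bounds the whole spectrum by `2^𝔠`. -/

noncomputable section

namespace HolSpectrum

/-! ### Characters of `𝒜_u(B_X)`, Gleason parts, and accumulation points. -/

section Characters

variable {X : Type*} [NormedAddCommGroup X] [NormedSpace ℂ X]

/-- The element of `𝒜_u(B_X)` given by a bounded, uniformly continuous, analytic function. -/
def Au.mk (F : X → ℂ) (hF : AnalyticOnNhd ℂ F (ball 0 1))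
    (hu : UniformContinuousOn F (ball 0 1)) (C : ℝ) (hC : ∀ x ∈ ball (0 : X) 1, ‖F x‖ ≤ C) :
    Au X :=
  ⟨BoundedContinuousFunction.ofNormedAddCommGroup (fun x : ball (0 : X) 1 => F x)
      (continuousOn_iff_continuous_domRestrict.1 hu.continuousOn) C (fun x => hC x x.2),
    uniformContinuousOn_iff_restrict.1 hu, F, hF, fun _ => rfl⟩

theorem Au.ext {f g : Au X}
    (h : ∀ x, (f : ball (0 : X) 1 →ᵇ ℂ) x = (g : ball (0 : X) 1 →ᵇ ℂ) x) : f = g :=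
  Subtype.ext (BoundedContinuousFunction.ext h)

theorem Au.norm_le {f : Au X} {C : ℝ} (hC : 0 ≤ C)
    (h : ∀ x, ‖(f : ball (0 : X) 1 →ᵇ ℂ) x‖ ≤ C) : ‖f‖ ≤ C :=
  (BoundedContinuousFunction.norm_le hC).2 h

theorem Au.norm_apply_le (f : Au X) (x : ball (0 : X) 1) :
    ‖(f : ball (0 : X) 1 →ᵇ ℂ) x‖ ≤ ‖f‖ :=
  (f : ball (0 : X) 1 →ᵇ ℂ).norm_coe_le_norm x

/-- If `f` is the restriction of a function continuous at `x`, then the extension of `f` takes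
the value of that function at `x`. -/
theorem extend_eq_of_continuousAt (f : Au X) {F : X → ℂ}
    (hf : ∀ x, (f : ball (0 : X) 1 →ᵇ ℂ) x = F x) {x : X} (hx : ‖x‖ ≤ 1)
    (hF : ContinuousAt F x) : extend f x = F x := by
  refine extend_eq_of_tendsto f hx ?_
  have : ((f : ball (0 : X) 1 →ᵇ ℂ) : ball (0 : X) 1 → ℂ) = F ∘ (↑) := funext hf
  rw [this]
  exact hF.tendsto.comp tendsto_comap

theorem ofDual_add (L L' : StrongDual ℂ X) : ofDual (L + L') = ofDual L + ofDual L' :=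
  Au.ext fun _ => rfl

theorem ofDual_sub (L L' : StrongDual ℂ X) : ofDual (L - L') = ofDual L - ofDual L' :=
  Au.ext fun _ => rfl

theorem ofDual_smul (c : ℂ) (L : StrongDual ℂ X) : ofDual (c • L) = c • ofDual L :=
  Au.ext fun _ => rfl

theorem ofDual_sum {ι : Type*} (s : Finset ι) (L : ι → StrongDual ℂ X) :
    ofDual (∑ i ∈ s, L i) = ∑ i ∈ s, ofDual (L i) := by
  classical
  induction s using Finset.induction_on with
  | empty => exact Au.ext fun _ => rfl
  | insert a s ha ih => rw [Finset.sum_insert ha, Finset.sum_insert ha, ofDual_add, ih]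

theorem norm_ofDual_le (L : StrongDual ℂ X) : ‖ofDual L‖ ≤ ‖L‖ :=
  Au.norm_le (norm_nonneg _) fun x => L.unit_le_opNorm _ (mem_ball_zero_iff.1 x.2).le

theorem Au.norm_pow_le (f : Au X) (n : ℕ) : ‖f ^ n‖ ≤ ‖f‖ ^ n := by
  induction n with
  | zero =>
    rw [pow_zero, pow_zero]
    exact Au.norm_le zero_le_one fun x => norm_one.le
  | succ n ih =>
    rw [pow_succ, pow_succ]
    exact (norm_mul_le _ _).trans (by gcongr)

theorem Spectrum.norm_apply_le_mul (φ : Spectrum X) (f : Au X) :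
    ‖φ f‖ ≤ ‖WeakDual.CharacterSpace.toCLM φ‖ * ‖f‖ :=
  (WeakDual.CharacterSpace.toCLM φ).le_opNorm f

/-- Characters have norm at most one. -/
theorem Spectrum.norm_apply_le (φ : Spectrum X) (f : Au X) : ‖φ f‖ ≤ ‖f‖ := by
  obtain ⟨C, hC⟩ : ∃ C, ∀ g : Au X, ‖φ g‖ ≤ C * ‖g‖ := ⟨_, φ.norm_apply_le_mul⟩
  have hC0 : 0 ≤ C := by
    have := (norm_nonneg _).trans (hC 1)
    have h1 : 0 < ‖(1 : Au X)‖ := norm_pos_iff.2 fun h => one_ne_zero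
      ((map_one φ).symm.trans ((congrArg φ h).trans (map_zero φ)))
    exact nonneg_of_mul_nonneg_left this h1
  -- Applying the crude bound to powers of `f` leaves `C` fixed while both sides grow geometrically,
  -- so `C` can be replaced by `1`.
  have key : ∀ n : ℕ, ‖φ f‖ ^ n ≤ C * ‖f‖ ^ n := by
    intro n
    rw [← norm_pow, ← map_pow]
    exact (hC _).trans (mul_le_mul_of_nonneg_left (Au.norm_pow_le f n) hC0)
  by_contra! h
  rcases (norm_nonneg f).eq_or_lt with h0 | h0
  · have : f = 0 := norm_eq_zero.1 h0.symm
    simp [this] at h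
  · have h1 : 1 < ‖φ f‖ / ‖f‖ := (one_lt_div h0).2 h
    obtain ⟨n, hn⟩ := pow_unbounded_of_one_lt C h1
    rw [div_pow, lt_div_iff₀ (by positivity)] at hn
    exact absurd (key n) hn.not_ge

theorem norm_sub_le_gleasonDist (φ ψ : Spectrum X) {f : Au X} (hf : ‖f‖ ≤ 1) :
    ‖φ f - ψ f‖ ≤ gleasonDist φ ψ :=
  ContinuousLinearMap.unit_le_opNorm
    (WeakDual.CharacterSpace.toCLM φ - WeakDual.CharacterSpace.toCLM ψ) f hf

theorem mem_gleasonPart_self (φ : Spectrum X) : φ ∈ gleasonPart φ := by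
  refine lt_of_le_of_lt (ContinuousLinearMap.opNorm_le_bound _ le_rfl fun f => ?_) two_pos
  change ‖φ f - φ f‖ ≤ _
  rw [sub_self, norm_zero, zero_mul]

theorem one_le_norm_one_sub {a : ℂ} (ha : a.re ≤ 0) : 1 ≤ ‖1 - a‖ := by
  have := Complex.re_le_norm (1 - a)
  simp only [Complex.sub_re, Complex.one_re] at this
  linarith

theorem norm_one_add_le_norm_one_sub {a : ℂ} (ha : a.re ≤ 0) : ‖1 + a‖ ≤ ‖1 - a‖ := by
  rw [Complex.norm_def, Complex.norm_def]
  refine Real.sqrt_le_sqrt ?_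
  simp only [Complex.normSq_apply, Complex.add_re, Complex.add_im, Complex.sub_re,
    Complex.sub_im, Complex.one_re, Complex.one_im]
  nlinarith

/-- The Cayley transform of a function with values in the closed left half plane. -/
theorem exists_cayley (g : Au X) (hg : ∀ x, ((g : ball (0 : X) 1 →ᵇ ℂ) x).re ≤ 0) :
    ∃ h : Au X, ‖h‖ ≤ 1 ∧ h * (1 - g) = 1 + g := by
  obtain ⟨G, hG, hGg⟩ := g.2.2
  have hre : ∀ x ∈ ball (0 : X) 1, (G x).re ≤ 0 := fun x hx => by
    rw [hGg ⟨x, hx⟩]; exact hg _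
  have h1 : ∀ x ∈ ball (0 : X) 1, 1 ≤ ‖1 - G x‖ := fun x hx => one_le_norm_one_sub (hre x hx)
  have h0 : ∀ x ∈ ball (0 : X) 1, 1 - G x ≠ 0 := fun x hx =>
    norm_pos_iff.1 (zero_lt_one.trans_le (h1 x hx))
  have hb : ∀ x ∈ ball (0 : X) 1, ‖(1 + G x) / (1 - G x)‖ ≤ 1 := fun x hx => by
    rw [norm_div]
    exact (div_le_one (zero_lt_one.trans_le (h1 x hx))).2 (norm_one_add_le_norm_one_sub (hre x hx))
  refine ⟨Au.mk (fun x => (1 + G x) / (1 - G x))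
    (fun x hx => ((analyticAt_const.add (hG x hx)).div (analyticAt_const.sub (hG x hx)) (h0 x hx)))
    ?_ 1 hb, Au.norm_le zero_le_one fun x => hb x x.2, Au.ext fun x => ?_⟩
  · have hgu := g.2.1
    rw [Metric.uniformContinuous_iff] at hgu
    rw [Metric.uniformContinuousOn_iff]
    intro ε hε
    obtain ⟨d, hd, H⟩ := hgu (ε / 2) (by positivity)
    refine ⟨d, hd, fun x hx y hy hxy => ?_⟩
    have e := H (a := ⟨x, hx⟩) (b := ⟨y, hy⟩) hxy
    rw [← hGg, ← hGg, dist_eq_norm] at e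
    -- As `|1 - G| ≥ 1`, the transform is `2`-Lipschitz in the value of `G`, so uniform continuity
    -- is inherited.
    have key : (1 + G x) / (1 - G x) - (1 + G y) / (1 - G y)
        = 2 * (G x - G y) / ((1 - G x) * (1 - G y)) := by
      have := h0 x hx
      have := h0 y hy
      field_simp
      ring
    rw [dist_eq_norm, key, norm_div, norm_mul, norm_mul]
    calc ‖(2 : ℂ)‖ * ‖G x - G y‖ / (‖1 - G x‖ * ‖1 - G y‖)
        ≤ ‖(2 : ℂ)‖ * ‖G x - G y‖ := by
          refine div_le_self (by positivity) ?_
          nlinarith [h1 x hx, h1 y hy]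
      _ < ε := by
          simp only [Complex.norm_ofNat] at *
          linarith
  · change (1 + G x) / (1 - G x) * (1 - (g : ball (0 : X) 1 →ᵇ ℂ) x)
      = 1 + (g : ball (0 : X) 1 →ᵇ ℂ) x
    rw [← hGg]
    exact div_mul_cancel₀ _ (h0 x x.2)

/-- Functions of norm at most one which are nearly `1` at `φ` are nearly `1` on the Gleason part
of `φ`. -/
theorem exists_forall_norm_sub_one_lt {φ ψ : Spectrum X} (h : gleasonDist φ ψ < 2) {η : ℝ}
    (hη : 0 < η) :
    ∃ ε > 0, ∀ f : Au X, ‖f‖ ≤ 1 → ‖φ f - 1‖ < ε → ‖ψ f - 1‖ < η := by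
  set δ := gleasonDist φ ψ
  have hδ : 0 < 2 - δ := by linarith
  -- The Cayley transform `k` of `t (f - 1)` sends `f = 1` to `1` and values far from `1` close to
  -- `-1`. With this `t` and the `ε` below, `φ k` is within `(2 - δ)/4` of `1` and, if `|ψ f - 1| ≥
  -- η`, `ψ k` is within `(2 - δ)/4` of `-1`; then `|φ k - ψ k| > δ`.
  set t : ℝ := (1 + 8 / (2 - δ)) / η
  have ht : 0 < t := by positivity
  refine ⟨(2 - δ) / (8 * t), by positivity, fun f hf hφ => ?_⟩
  by_contra! hψ
  set g : Au X := f - 1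
  obtain ⟨k, hk, hkg⟩ := exists_cayley ((t : ℂ) • g) (fun x => by
    change ((t : ℂ) * ((f : ball (0 : X) 1 →ᵇ ℂ) x - 1)).re ≤ 0
    rw [Complex.re_ofReal_mul, Complex.sub_re, Complex.one_re]
    have := (Complex.re_le_norm _).trans ((Au.norm_apply_le f x).trans hf)
    exact mul_nonpos_of_nonneg_of_nonpos ht.le (by linarith))
  have hval : ∀ χ : Spectrum X, χ k * (1 - t * (χ f - 1)) = 1 + t * (χ f - 1) := by
    intro χ
    have := congrArg χ hkg
    simpa only [g, map_mul, map_add, map_sub, map_one, map_smul, smul_eq_mul] using this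
  have hre : ∀ χ : Spectrum X, (t * (χ f - 1) : ℂ).re ≤ 0 := by
    intro χ
    rw [Complex.re_ofReal_mul, Complex.sub_re, Complex.one_re]
    have := (Complex.re_le_norm _).trans ((χ.norm_apply_le f).trans hf)
    exact mul_nonpos_of_nonneg_of_nonpos ht.le (by linarith)
  have a1 : ‖φ k - 1‖ ≤ 2 * (t * ‖φ f - 1‖) := by
    have h1 := one_le_norm_one_sub (hre φ)
    have : (φ k - 1) * (1 - t * (φ f - 1)) = 2 * (t * (φ f - 1)) := by
      linear_combination hval φ
    have hn := congrArg norm this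
    rw [norm_mul, norm_mul, norm_mul, Complex.norm_real, Real.norm_of_nonneg ht.le,
      Complex.norm_ofNat] at hn
    rw [← hn]
    exact le_mul_of_one_le_right (norm_nonneg _) h1
  have a2 : ‖ψ k + 1‖ * (t * ‖ψ f - 1‖ - 1) ≤ 2 := by
    have : (ψ k + 1) * (1 - t * (ψ f - 1)) = 2 := by
      linear_combination hval ψ
    have hn := congrArg norm this
    rw [norm_mul, Complex.norm_ofNat] at hn
    rw [← hn]
    gcongr
    have := norm_sub_norm_le (t * (ψ f - 1) : ℂ) 1
    rw [norm_mul, Complex.norm_real, Real.norm_of_nonneg ht.le, norm_one] at this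
    rwa [norm_sub_rev 1]
  have a3 : ‖φ k - ψ k‖ ≤ δ := norm_sub_le_gleasonDist φ ψ hk
  have a4 : 2 ≤ ‖φ k - ψ k‖ + ‖φ k - 1‖ + ‖ψ k + 1‖ := by
    have e : (2 : ℂ) = (φ k - ψ k) - (φ k - 1) + (ψ k + 1) := by ring
    calc (2 : ℝ) = ‖(2 : ℂ)‖ := by simp
      _ ≤ _ := by
        rw [e]
        exact (norm_add_le _ _).trans (by gcongr; exact norm_sub_le _ _)
  have b1 : 2 * (t * ‖φ f - 1‖) < (2 - δ) / 4 := by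
    calc 2 * (t * ‖φ f - 1‖) < 2 * (t * ((2 - δ) / (8 * t))) := by gcongr
      _ = (2 - δ) / 4 := by field_simp; norm_num
  have b2 : 8 / (2 - δ) ≤ t * ‖ψ f - 1‖ - 1 := by
    have : t * η ≤ t * ‖ψ f - 1‖ := by gcongr
    have e : t * η = 1 + 8 / (2 - δ) := div_mul_cancel₀ _ hη.ne'
    linarith
  have b3 : ‖ψ k + 1‖ ≤ (2 - δ) / 4 := by
    have h8 : 0 < 8 / (2 - δ) := by positivity
    have : ‖ψ k + 1‖ * (8 / (2 - δ)) ≤ 2 :=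
      (mul_le_mul_of_nonneg_left b2 (norm_nonneg _)).trans a2
    rw [← le_div_iff₀ h8] at this
    calc ‖ψ k + 1‖ ≤ 2 / (8 / (2 - δ)) := this
      _ = (2 - δ) / 4 := by field_simp; norm_num
  linarith

theorem tendsto_one_of_mem_gleasonPart {φ ψ : Spectrum X} (h : ψ ∈ gleasonPart φ)
    {ι : Type*} {l : Filter ι} {f : ι → Au X} (hf : ∀ i, ‖f i‖ ≤ 1)
    (hφ : Tendsto (fun i => φ (f i)) l (𝓝 1)) : Tendsto (fun i => ψ (f i)) l (𝓝 1) := by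
  rw [Metric.tendsto_nhds] at hφ ⊢
  intro η hη
  obtain ⟨ε, hε, H⟩ := exists_forall_norm_sub_one_lt h hη
  filter_upwards [hφ ε hε] with i hi
  rw [dist_eq_norm] at hi ⊢
  exact H _ (hf i) hi

/-- The Gleason parts of `φ` and `φ'` are disjoint if functions of norm at most one take values
arbitrarily close to `1` at `φ` and simultaneously to `-1` at `φ'`. -/
theorem disjoint_gleasonPart {φ φ' : Spectrum X} {ι : Type*} {l : Filter ι} [NeBot l]
    {f : ι → Au X} (hf : ∀ i, ‖f i‖ ≤ 1) (hφ : Tendsto (fun i => φ (f i)) l (𝓝 1))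
    (hφ' : Tendsto (fun i => φ' (f i)) l (𝓝 (-1))) :
    Disjoint (gleasonPart φ) (gleasonPart φ') := by
  rw [Set.disjoint_left]
  intro ψ h h'
  have h1 := tendsto_one_of_mem_gleasonPart h hf hφ
  have h2 := tendsto_one_of_mem_gleasonPart (f := fun i => -f i) h'
    (fun i => by rw [norm_neg]; exact hf i)
    (by simpa only [map_neg, neg_neg] using hφ'.neg)
  simp only [map_neg] at h2
  have := tendsto_nhds_unique h1.neg h2
  norm_num at this

/-- The exponential of a continuous linear functional, as an element of `𝒜_u(B_X)`. -/
def expDual (L : StrongDual ℂ X) : Au X :=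
  Au.mk (fun x => Complex.exp (L x)) (fun x _ => (L.analyticAt x).cexp)
    (by
      have h1 : Set.MapsTo L (ball 0 1) (closedBall 0 ‖L‖) := fun x hx =>
        mem_closedBall_zero_iff.2 (L.unit_le_opNorm _ (mem_ball_zero_iff.1 hx).le)
      exact ((isCompact_closedBall (0 : ℂ) ‖L‖).uniformContinuousOn_of_continuous
        Complex.continuous_exp.continuousOn).comp L.uniformContinuous.uniformContinuousOn h1)
    (Real.exp ‖L‖) (fun x hx => by
      rw [Complex.norm_exp]
      exact Real.exp_le_exp.2 ((Complex.re_le_norm _).trans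
        (L.unit_le_opNorm _ (mem_ball_zero_iff.1 hx).le)))

theorem expDual_apply (L : StrongDual ℂ X) (x : ball (0 : X) 1) :
    (expDual L : ball (0 : X) 1 →ᵇ ℂ) x = Complex.exp (L x) := rfl

/-- Norm convergence of the exponential series is what lets a character pass through `exp`. The sum
is taken in the complete algebra of bounded continuous functions and pulled back along the
inclusion. -/
theorem hasSum_expDual (L : StrongDual ℂ X) :
    HasSum (fun n : ℕ => (n.factorial⁻¹ : ℂ) • ofDual L ^ n) (expDual L) := by
  have hi : IsInducing ((↑) : Au X → (ball (0 : X) 1 →ᵇ ℂ)) := IsInducing.subtypeVal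
  have hs := NormedSpace.exp_series_hasSum_exp' (𝕂 := ℂ) (ofDual L : ball (0 : X) 1 →ᵇ ℂ)
  have he : NormedSpace.exp (ofDual L : ball (0 : X) 1 →ᵇ ℂ) = expDual L := by
    ext x
    have h1 := (BoundedContinuousFunction.evalCLM ℂ x).hasSum hs
    have h2 := NormedSpace.exp_series_hasSum_exp' (𝕂 := ℂ) (L (x : X))
    rw [expDual_apply, Complex.exp_eq_exp_ℂ]
    exact h1.unique h2
  rw [he] at hs
  exact (hi.hasSum_iff (g := (Au X).val) _ _).1 hs

theorem Spectrum.apply_expDual (φ : Spectrum X) (L : StrongDual ℂ X) :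
    φ (expDual L) = Complex.exp (φ (ofDual L)) := by
  have h1 := (WeakDual.CharacterSpace.toCLM φ).hasSum (hasSum_expDual L)
  have h2 := NormedSpace.exp_series_hasSum_exp' (𝕂 := ℂ) (φ (ofDual L))
  rw [Complex.exp_eq_exp_ℂ]
  refine h1.unique ?_
  convert h2 using 2 with n
  change φ _ = _
  rw [map_smul, map_pow]

/-- Banach–Alaoglu, as characters form a weak-star closed subset of the dual unit ball. Compactness
gives a limit along every ultrafilter. -/
instance : CompactSpace (Spectrum X) := by
  rw [← isCompact_iff_compactSpace]
  have h : WeakDual.characterSpace ℂ (Au X) ⊆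
      WeakDual.toStrongDual ⁻¹' Metric.closedBall 0 1 := by
    intro φ hφ
    refine (mem_closedBall_zero_iff (E := Au X →L[ℂ] ℂ)).2 ?_
    refine ContinuousLinearMap.opNorm_le_bound _ zero_le_one fun f => ?_
    rw [one_mul]
    exact Spectrum.norm_apply_le ⟨φ, hφ⟩ f
  exact (WeakDual.isCompact_closedBall 0 1).of_isClosed_subset
    WeakDual.CharacterSpace.isClosed h

theorem Spectrum.continuous_eval (f : Au X) : Continuous fun φ : Spectrum X => φ f :=
  (WeakDual.eval_continuous f).comp continuous_subtype_val

/-- The accumulation points of a sequence are its limits along the ultrafilters at infinity. -/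
theorem mem_wstarAcc_iff {φ : ℕ → Spectrum X} {ψ : Spectrum X} :
    ψ ∈ wstarAcc φ ↔ ∃ U : Ultrafilter ℕ, ↑U ≤ (atTop : Filter ℕ) ∧ Tendsto φ U (𝓝 ψ) :=
  mapClusterPt_iff_ultrafilter

theorem exists_mem_wstarAcc (φ : ℕ → Spectrum X) {U : Ultrafilter ℕ}
    (hU : ↑U ≤ (atTop : Filter ℕ)) : ∃ ψ ∈ wstarAcc φ, Tendsto φ U (𝓝 ψ) := by
  obtain ⟨ψ, -, hψ⟩ := isCompact_univ.ultrafilter_le_nhds (U.map φ) (by simp)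
  exact ⟨ψ, mem_wstarAcc_iff.2 ⟨U, hU, hψ⟩, hψ⟩

/-- An element of the algebra is determined by its values on a countable dense set, so the algebra
has at most `𝔠` elements and there are at most `𝔠 ^ 𝔠` functions on it. -/
theorem mk_spectrum_le {X : Type} [NormedAddCommGroup X] [NormedSpace ℂ X]
    [TopologicalSpace.SeparableSpace X] : #(Spectrum X) ≤ 2 ^ 𝔠 := by
  have : TopologicalSpace.SeparableSpace (ball (0 : X) 1) :=
    (TopologicalSpace.IsSeparable.of_separableSpace _).separableSpace
  obtain ⟨D, hD, hDd⟩ := TopologicalSpace.exists_countable_dense (ball (0 : X) 1)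
  have h1 : #(Au X) ≤ 𝔠 := by
    have inj : Function.Injective
        (fun (f : Au X) (x : D) => (f : ball (0 : X) 1 →ᵇ ℂ) x) := by
      intro f g h
      refine Subtype.ext (DFunLike.coe_injective ?_)
      refine Continuous.ext_on hDd (map_continuous _) (map_continuous _) fun x hx => ?_
      exact congrFun h ⟨x, hx⟩
    calc #(Au X) ≤ #(D → ℂ) := mk_le_of_injective inj
      _ = 𝔠 ^ #D := by rw [← mk_complex]; rfl
      _ ≤ 𝔠 ^ ℵ₀ := power_le_power_left continuum_ne_zero (mk_le_aleph0_iff.2 hD.to_subtype)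
      _ = 𝔠 := continuum_power_aleph0
  calc #(Spectrum X) ≤ #(Au X → ℂ) := mk_le_of_injective DFunLike.coe_injective
    _ = 𝔠 ^ #(Au X) := by rw [← mk_complex]; rfl
    _ ≤ 𝔠 ^ 𝔠 := power_le_power_left continuum_ne_zero h1
    _ = 2 ^ 𝔠 := power_self_eq aleph0_le_continuum

end Characters

/-! ### Young's inequality and its case of equality. -/

section Young

/-- The derivative of `‖y‖ ^ r / r`, in the form `‖y‖ ^ (r - 2) * conj y`. -/
def dualityMap (r : ℝ) (y : ℂ) : ℂ := (‖y‖ ^ (r - 2) : ℝ) * starRingEnd ℂ y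

theorem dualityMap_mul_self {r : ℝ} (hr : 1 < r) (y : ℂ) :
    dualityMap r y * y = (‖y‖ ^ r : ℝ) := by
  rw [dualityMap, mul_assoc, Complex.conj_mul']
  rcases eq_or_ne y 0 with rfl | hy
  · simp [Real.zero_rpow (by linarith : r ≠ 0)]
  · have h : 0 < ‖y‖ := norm_pos_iff.2 hy
    rw [← Complex.ofReal_pow, ← Complex.ofReal_mul, ← Real.rpow_natCast, ← Real.rpow_add h]
    norm_num

theorem norm_dualityMap {r : ℝ} (hr : 1 < r) (y : ℂ) : ‖dualityMap r y‖ = ‖y‖ ^ (r - 1) := by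
  rw [dualityMap, norm_mul, Complex.norm_real, RCLike.norm_conj,
    Real.norm_of_nonneg (by positivity)]
  rcases eq_or_ne y 0 with rfl | hy
  · simp [Real.zero_rpow (by linarith : r - 1 ≠ 0)]
  · have h : 0 < ‖y‖ := norm_pos_iff.2 hy
    rw [← Real.rpow_add_one h.ne']
    ring_nf

/-- For `b > 0` this is the strict Bernoulli inequality at `a / b - 1`, multiplied by `b ^ r`. -/
theorem young_real_lt {r a b : ℝ} (hr : 1 < r) (ha : 0 ≤ a) (hb : 0 ≤ b) (hab : a ≠ b) :
    r * (b ^ (r - 1) * a) < a ^ r + (r - 1) * b ^ r := by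
  rcases hb.eq_or_lt with rfl | hb
  · have : 0 < a := ha.lt_of_ne' hab
    rw [Real.zero_rpow (by linarith), Real.zero_rpow (by linarith)]
    have := Real.rpow_pos_of_pos this r
    linarith
  · have h := one_add_mul_self_lt_rpow_one_add (s := a / b - 1) (p := r)
      (by have : 0 ≤ a / b := by positivity
          linarith) (by rwa [ne_eq, sub_eq_zero, div_eq_one_iff_eq hb.ne']) hr
    rw [add_sub_cancel, Real.div_rpow ha hb.le, lt_div_iff₀ (by positivity)] at h
    have e : b ^ r = b ^ (r - 1) * b := by rw [← Real.rpow_add_one hb.ne']; ring_nf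
    calc r * (b ^ (r - 1) * a) = (1 + r * (a / b - 1)) * b ^ r + (r - 1) * b ^ r := by
          rw [e]; field_simp; ring
      _ < _ := by linarith

theorem young_real_le {r a b : ℝ} (hr : 1 < r) (ha : 0 ≤ a) (hb : 0 ≤ b) :
    r * (b ^ (r - 1) * a) ≤ a ^ r + (r - 1) * b ^ r := by
  rcases eq_or_ne a b with rfl | hab
  · rcases ha.eq_or_lt with rfl | h
    · rw [Real.zero_rpow (by linarith), Real.zero_rpow (by linarith)]; simp
    · rw [← Real.rpow_add_one h.ne', sub_add_cancel]; linarith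
  · exact (young_real_lt hr ha hb hab).le

theorem re_dualityMap_mul_le {r : ℝ} (hr : 1 < r) (x y : ℂ) :
    (dualityMap r y * x).re ≤ ‖y‖ ^ (r - 1) * ‖x‖ := by
  rw [← norm_dualityMap hr, ← norm_mul]
  exact Complex.re_le_norm _

/-- Young's inequality for the duality map. -/
theorem young_dualityMap {r : ℝ} (hr : 1 < r) (x y : ℂ) :
    r * (dualityMap r y * x).re ≤ ‖x‖ ^ r + (r - 1) * ‖y‖ ^ r :=
  (mul_le_mul_of_nonneg_left (re_dualityMap_mul_le hr x y) (by linarith)).trans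
    (young_real_le hr (norm_nonneg x) (norm_nonneg y))

/-- The case of equality in Young's inequality. -/
theorem eq_of_le_young_dualityMap {r : ℝ} (hr : 1 < r) {x y : ℂ}
    (h : ‖x‖ ^ r + (r - 1) * ‖y‖ ^ r ≤ r * (dualityMap r y * x).re) : x = y := by
  have h0 := mul_le_mul_of_nonneg_left (re_dualityMap_mul_le hr x y) (by linarith : 0 ≤ r)
  have hxy : ‖x‖ = ‖y‖ := by
    by_contra hne
    exact absurd (h.trans h0) (young_real_lt hr (norm_nonneg x) (norm_nonneg y) hne).not_ge
  rcases eq_or_ne y 0 with rfl | hy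
  · simpa using hxy
  have hy0 : 0 < ‖y‖ := norm_pos_iff.2 hy
  have e : ‖y‖ ^ r = ‖y‖ ^ (r - 2) * ‖y‖ ^ 2 := by
    rw [← Real.rpow_natCast, ← Real.rpow_add hy0]; norm_num
  rw [hxy, e, dualityMap, mul_assoc, Complex.re_ofReal_mul] at h
  have hp : 0 < r * ‖y‖ ^ (r - 2) := by have := Real.rpow_pos_of_pos hy0 (r - 2); positivity
  -- The moduli agree by strictness of the real inequality; what remains fixes the phase, since
  -- expanding `‖x - y‖ ^ 2` now leaves nothing positive.
  have h2 : ‖y‖ ^ 2 ≤ (starRingEnd ℂ y * x).re := by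
    refine le_of_mul_le_mul_left ?_ hp
    linarith
  have h3 : ‖x - y‖ ^ 2 ≤ 0 := by
    have h4 : ‖x - y‖ ^ 2 = ‖x‖ ^ 2 + ‖y‖ ^ 2 - 2 * (starRingEnd ℂ y * x).re := by
      simp only [Complex.sq_norm, Complex.normSq_apply, Complex.mul_re, Complex.conj_re,
        Complex.conj_im, Complex.sub_re, Complex.sub_im]
      ring
    rw [h4, hxy]
    linarith
  have h5 : ‖x - y‖ = 0 := by nlinarith [norm_nonneg (x - y)]
  exact sub_eq_zero.1 (norm_eq_zero.1 h5)

end Young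

/-! ### Truncations, separability and the dual of `ℓ_p`. -/

section SequenceSpace

/-- Each term is at most the sum `S`, so `t_n ^ m ≤ t_n * S ^ (m - 1)`. It is used with `t_n = |x_n|
^ p` and `m = N / p`. -/
theorem summable_rpow_and_tsum_rpow_le {t : ℕ → ℝ} (ht : ∀ n, 0 ≤ t n) (hs : Summable t) {m : ℝ}
    (hm : 1 ≤ m) : Summable (fun n => t n ^ m) ∧ ∑' n, t n ^ m ≤ (∑' n, t n) ^ m := by
  set S := ∑' n, t n
  have hS : 0 ≤ S := tsum_nonneg ht
  have e : ∀ a : ℝ, 0 ≤ a → a ^ m = a * a ^ (m - 1) := fun a ha => by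
    rw [← Real.rpow_one_add' ha (by linarith)]; ring_nf
  have hle : ∀ n, t n ^ m ≤ t n * S ^ (m - 1) := fun n => by
    rw [e _ (ht n)]
    exact mul_le_mul_of_nonneg_left (Real.rpow_le_rpow (ht n)
      (hs.le_tsum n fun i _ => ht i) (by linarith)) (ht n)
  have h2 := hs.mul_right (S ^ (m - 1))
  have h1 : Summable (fun n => t n ^ m) :=
    h2.of_nonneg_of_le (fun n => Real.rpow_nonneg (ht n) _) hle
  refine ⟨h1, (h1.tsum_le_tsum hle h2).trans_eq ?_⟩
  rw [tsum_mul_right, e S hS]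

variable {p : ℝ≥0∞} [Fact (1 ≤ p)]

theorem toReal_pos_of_fact (hp : p ≠ ∞) : 0 < p.toReal :=
  ENNReal.toReal_pos (zero_lt_one.trans_le (Fact.out : 1 ≤ p)).ne' hp

variable (p) in
/-- The coordinate functionals on `ℓ_p`. -/
def coord (i : ℕ) : StrongDual ℂ (EllP p) := lp.evalCLM ℂ (fun _ : ℕ => ℂ) p i

theorem coord_apply (i : ℕ) (x : EllP p) : coord p i x = x i := rfl

theorem tendsto_truncation (hp : p ≠ ∞) (z : EllP p) :
    Tendsto (truncation z) atTop (𝓝 z) :=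
  (lp.hasSum_single hp z).tendsto_sum_nat

theorem separableSpace_ellP (hp : p ≠ ∞) : TopologicalSpace.SeparableSpace (EllP p) := by
  have h1 : TopologicalSpace.IsSeparable
      (Submodule.span ℂ (Set.range fun i => (lp.single p i (1 : ℂ) : EllP p)) : Set (EllP p)) :=
    (Set.countable_range _).isSeparable.span
  have h2 : (Set.univ : Set (EllP p)) ⊆ closure
      (Submodule.span ℂ (Set.range fun i => (lp.single p i (1 : ℂ) : EllP p)) : Set (EllP p)) := by
    intro z _
    refine mem_closure_of_tendsto (tendsto_truncation hp z) (Eventually.of_forall fun n => ?_)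
    refine Submodule.sum_mem _ fun i _ => ?_
    have : (lp.single p i (z i) : EllP p) = z i • lp.single p i (1 : ℂ) := by
      rw [← lp.single_smul, smul_eq_mul, mul_one]
    rw [this]
    exact Submodule.smul_mem _ _ (Submodule.subset_span ⟨i, rfl⟩)
  exact TopologicalSpace.isSeparable_univ_iff.1 (h1.closure.mono h2)

/-- The finite linear combinations of the coordinate functionals are dense in the dual of `ℓ_p`. -/
theorem tendsto_sum_coord (hp1 : 1 < p) (hp : p ≠ ∞) (L : StrongDual ℂ (EllP p)) :
    Tendsto (fun M => ∑ i ∈ Finset.range M, L (lp.single p i 1) • coord p i) atTop (𝓝 L) := by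
  set r := p.toReal
  have hr : 1 < r := by
    have := (ENNReal.toReal_lt_toReal ENNReal.one_ne_top hp).2 hp1
    simpa using this
  set b : ℕ → ℂ := fun i => L (lp.single p i 1)
  set q := ENNReal.conjExponent p
  have hpq : p.HolderConjugate q := inferInstance
  have hqp : q.HolderConjugate p := hpq.symm
  have hq1 : Fact (1 ≤ q) := ⟨ENNReal.HolderConjugate.one_le q p⟩
  -- This is where `p > 1` matters: truncations converge in `ℓ_q` because `q` is finite.
  have hq : q ≠ ∞ := by
    intro h
    rw [h] at hqp
    have := ENNReal.HolderConjugate.inv_add_inv_eq_one ∞ p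
    rw [ENNReal.inv_top, zero_add, ENNReal.inv_eq_one] at this
    exact hp1.ne' this
  have hrq : r.HolderConjugate q.toReal := ENNReal.HolderConjugate.toReal_of_ne_top hp hq
  have hq0 : 0 < q.toReal := hrq.symm.pos
  have hsum : ∀ s : Finset ℕ, ∑ i ∈ s, ‖b i‖ ^ q.toReal ≤ ‖L‖ ^ q.toReal := by
    intro s
    set S := ∑ i ∈ s, ‖b i‖ ^ q.toReal
    have hS : 0 ≤ S := Finset.sum_nonneg fun i _ => by positivity
    -- The extremal vector in Hölder's inequality: `L y` and `‖y‖ ^ r` both equal `S`, so `S ≤ ‖L‖ *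
    -- S ^ (1 / r)`, which bounds `S`.
    set y : EllP p := ∑ i ∈ s, lp.single p i (dualityMap q.toReal (b i))
    have hy : ‖y‖ ^ r = S := by
      rw [lp.norm_sum_single (by linarith)]
      refine Finset.sum_congr rfl fun i _ => ?_
      rw [norm_dualityMap hrq.symm.lt, ← Real.rpow_mul (norm_nonneg _)]
      congr 1
      rw [mul_comm]
      have : r * q.toReal = r + q.toReal := hrq.mul_eq_add
      change r * (q.toReal - 1) = q.toReal
      linarith
    have hLy : L y = (S : ℂ) := by
      rw [map_sum, Complex.ofReal_sum]
      refine Finset.sum_congr rfl fun i _ => ?_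
      have : (lp.single p i (dualityMap q.toReal (b i)) : EllP p)
          = dualityMap q.toReal (b i) • lp.single p i (1 : ℂ) := by
        rw [← lp.single_smul, smul_eq_mul, mul_one]
      rw [this, map_smul, smul_eq_mul]
      exact dualityMap_mul_self hrq.symm.lt _
    have h1 : S ≤ ‖L‖ * S ^ (1 / r) := by
      have := L.le_opNorm y
      rw [hLy, Complex.norm_real, Real.norm_of_nonneg hS] at this
      rwa [← hy, one_div, Real.rpow_rpow_inv (norm_nonneg _) (by linarith), hy]
    rcases hS.eq_or_lt with h0 | h0
    · rw [← h0]; positivity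
    · have h2 : S ^ (1 / q.toReal) ≤ ‖L‖ := by
        have e : S ^ (1 / q.toReal) * S ^ (1 / r) = S := by
          rw [← Real.rpow_add h0, hrq.symm.one_div_add_one_div, div_one, Real.rpow_one]
        refine le_of_mul_le_mul_right ?_ (Real.rpow_pos_of_pos h0 (1 / r))
        rwa [e]
      have := Real.rpow_le_rpow (by positivity) h2 hq0.le
      rwa [one_div, Real.rpow_inv_rpow hS hq0.ne'] at this
  set β : EllP q := ⟨b, memℓp_gen' hsum⟩
  set B := lp.dualPairing (ι := ℕ) (E := fun _ => ℂ) (F := fun _ => ℂ) q p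
    (fun _ => ContinuousLinearMap.mul ℂ ℂ) (K := 1) (fun _ => by simp)
  have hB : ∀ c x, B c x = ∑' i, c i * x i := fun _ _ => rfl
  have hBs : ∀ i (a : ℂ), B (lp.single q i a) = a • coord p i := by
    intro i a
    ext x
    rw [hB, tsum_eq_single i]
    · simp [coord_apply]
    · intro j hj
      simp [lp.single_apply, hj]
  have hBβ : B β = L := by
    ext x
    have h := L.hasSum (lp.hasSum_single hp x)
    rw [hB, ← h.tsum_eq]
    refine tsum_congr fun i => ?_
    have : (lp.single p i (x i) : EllP p) = x i • lp.single p i (1 : ℂ) := by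
      rw [← lp.single_smul, smul_eq_mul, mul_one]
    rw [this, map_smul, smul_eq_mul, mul_comm]
  -- The coefficient sequence lies in `ℓ_q`, and the continuous pairing carries its truncations to
  -- the partial sums of `L`.
  have hlim := (B.continuous.tendsto β).comp (tendsto_truncation hq β)
  rw [hBβ] at hlim
  refine hlim.congr fun M => ?_
  rw [Function.comp, truncation, map_sum]
  exact Finset.sum_congr rfl fun i _ => hBs i _

end SequenceSpace

/-! ### Diagonal polynomials as elements of the algebra. -/

section PowerSum

variable {p : ℝ≥0∞} [Fact (1 ≤ p)]

/-- The homogeneous polynomial `x ↦ ∑ ε n * x n ^ N` on `ℓ_p`. -/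
def powerSum (ε : ℕ → ℂ) (N : ℕ) (x : EllP p) : ℂ := ∑' n, ε n * x n ^ N

theorem norm_pow_eq_rpow (hp : p ≠ ∞) (a : ℂ) (N : ℕ) :
    ‖a‖ ^ N = (‖a‖ ^ p.toReal) ^ (N / p.toReal) := by
  rw [← Real.rpow_mul (norm_nonneg _), mul_div_cancel₀ _ (toReal_pos_of_fact hp).ne',
    Real.rpow_natCast]

theorem hasSum_tail_norm_rpow (hp : p ≠ ∞) (M : ℕ) (x : EllP p) :
    HasSum (fun n => if n < M then 0 else ‖x n‖ ^ p.toReal)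
      (‖x‖ ^ p.toReal - ∑ i ∈ Finset.range M, ‖x i‖ ^ p.toReal) := by
  have h1 := lp.hasSum_norm (toReal_pos_of_fact hp) x
  have h2 := hasSum_sum_of_ne_finset_zero (s := Finset.range M)
    (f := fun n => if n < M then ‖x n‖ ^ p.toReal else 0) (L := .unconditional ℕ)
    (fun n hn => if_neg (by simpa using hn))
  rw [Finset.sum_congr rfl fun i hi => if_pos (Finset.mem_range.1 hi)] at h2
  refine (h1.sub h2).congr_fun ?_
  intro n
  split_ifs <;> simp

theorem summable_norm_pow (hp : p ≠ ∞) {N : ℕ} (hN : p.toReal ≤ N) (x : EllP p) :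
    Summable (fun n => ‖x n‖ ^ N) ∧ ∑' n, ‖x n‖ ^ N ≤ ‖x‖ ^ N := by
  have hr := toReal_pos_of_fact hp
  have h1 := lp.hasSum_norm hr x
  have h2 := summable_rpow_and_tsum_rpow_le (t := fun n => ‖x n‖ ^ p.toReal)
    (fun n => by positivity) h1.summable (m := N / p.toReal) ((one_le_div hr).2 hN)
  rw [h1.tsum_eq, ← Real.rpow_mul (norm_nonneg _), mul_div_cancel₀ _ hr.ne',
    Real.rpow_natCast] at h2
  simpa only [norm_pow_eq_rpow hp] using h2

/-- Coefficients vanish below `M`, so only the mass of `x` beyond `M` enters. The constant `1` here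
is essential: the peak functions need a sharp bound. -/
theorem norm_powerSum_le (hp : p ≠ ∞) {N : ℕ} (hN : p.toReal ≤ N) {ε : ℕ → ℂ}
    (hε : ∀ n, ‖ε n‖ ≤ 1) {M : ℕ} (hM : ∀ n < M, ε n = 0) (x : EllP p) :
    ‖powerSum ε N x‖ ≤
      (‖x‖ ^ p.toReal - ∑ i ∈ Finset.range M, ‖x i‖ ^ p.toReal) ^ (N / p.toReal) := by
  have hr := toReal_pos_of_fact hp
  have h1 := hasSum_tail_norm_rpow hp M x
  have h2 := summable_rpow_and_tsum_rpow_le (t := fun n => if n < M then 0 else ‖x n‖ ^ p.toReal)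
    (fun n => by split_ifs <;> positivity) h1.summable (m := N / p.toReal) ((one_le_div hr).2 hN)
  rw [h1.tsum_eq] at h2
  refine (tsum_of_norm_bounded h2.1.hasSum fun n => ?_).trans h2.2
  split_ifs with h
  · rw [hM n h, zero_mul, norm_zero]; positivity
  · rw [norm_mul, norm_pow, ← norm_pow_eq_rpow hp]
    exact mul_le_of_le_one_left (by positivity) (hε n)

/-- A crude bound through the largest factor. It only serves continuity of the multilinear form,
where the loss of a factor `N` is harmless. -/
theorem norm_prod_le_sum_pow {N : ℕ} (hN : 0 < N) (a : Fin N → ℂ) :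
    ‖∏ i, a i‖ ≤ ∑ i, ‖a i‖ ^ N := by
  have : Nonempty (Fin N) := ⟨⟨0, hN⟩⟩
  obtain ⟨j, hj⟩ := Finite.exists_max fun i => ‖a i‖
  calc ‖∏ i, a i‖ = ∏ i, ‖a i‖ := norm_prod _ _
    _ ≤ ∏ _i : Fin N, ‖a j‖ := Finset.prod_le_prod (fun i _ => norm_nonneg _) fun i _ => hj i
    _ = ‖a j‖ ^ N := by simp
    _ ≤ ∑ i, ‖a i‖ ^ N :=
      Finset.single_le_sum (f := fun i => ‖a i‖ ^ N) (fun i _ => by positivity)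
        (Finset.mem_univ j)

theorem summable_diagonal (hp : p ≠ ∞) {N : ℕ} (hN : p.toReal ≤ N) {ε : ℕ → ℂ}
    (hε : ∀ n, ‖ε n‖ ≤ 1) (m : Fin N → EllP p) :
    Summable (fun n => ε n * ∏ i, m i n) ∧
      ‖∑' n, ε n * ∏ i, m i n‖ ≤ ∑ i, ‖m i‖ ^ N := by
  have hN0 : 0 < N := by exact_mod_cast (toReal_pos_of_fact hp).trans_le hN
  have h1 : HasSum (fun n => ∑ i, ‖m i n‖ ^ N) (∑ i, ∑' n, ‖m i n‖ ^ N) :=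
    hasSum_sum fun i _ => (summable_norm_pow hp hN (m i)).1.hasSum
  have h2 : ∀ n, ‖ε n * ∏ i, m i n‖ ≤ ∑ i, ‖m i n‖ ^ N := fun n => by
    rw [norm_mul]
    exact (mul_le_of_le_one_left (norm_nonneg _) (hε n)).trans (norm_prod_le_sum_pow hN0 _)
  exact ⟨Summable.of_norm_bounded h1.summable h2, (tsum_of_norm_bounded h1 h2).trans
    (Finset.sum_le_sum fun i _ => (summable_norm_pow hp hN (m i)).2)⟩

theorem prod_coord_apply {N : ℕ} (n : ℕ) (m : Fin N → EllP p) :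
    (MultilinearMap.mkPiAlgebra ℂ (Fin N) ℂ).compLinearMap
      (fun _ => (coord p n).toLinearMap) m = ∏ i, m i n := by
  rw [MultilinearMap.compLinearMap_apply, MultilinearMap.mkPiAlgebra_apply]
  rfl

/-- The multilinear form whose restriction to the diagonal is `powerSum ε N`. -/
def powerSumForm (hp : p ≠ ∞) {N : ℕ} (hN : p.toReal ≤ N) {ε : ℕ → ℂ} (hε : ∀ n, ‖ε n‖ ≤ 1) :
    MultilinearMap ℂ (fun _ : Fin N => EllP p) ℂ where
  toFun m := ∑' n, ε n * ∏ i, m i n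
  map_update_add' m i x y := by
    rw [← Summable.tsum_add (summable_diagonal hp hN hε _).1 (summable_diagonal hp hN hε _).1]
    refine tsum_congr fun n => ?_
    rw [← prod_coord_apply, ← prod_coord_apply, ← prod_coord_apply,
      MultilinearMap.map_update_add, mul_add]
  map_update_smul' m i c x := by
    rw [smul_eq_mul, ← tsum_mul_left]
    refine tsum_congr fun n => ?_
    rw [← prod_coord_apply, ← prod_coord_apply, MultilinearMap.map_update_smul, smul_eq_mul,
      mul_left_comm]

theorem norm_powerSumForm_le (hp : p ≠ ∞) {N : ℕ} (hN : p.toReal ≤ N) {ε : ℕ → ℂ}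
    (hε : ∀ n, ‖ε n‖ ≤ 1) (m : Fin N → EllP p) :
    ‖powerSumForm hp hN hε m‖ ≤ N * ∏ i, ‖m i‖ := by
  by_cases h : ∃ i, m i = 0
  · obtain ⟨i, hi⟩ := h
    rw [MultilinearMap.map_coord_zero _ i hi, norm_zero]
    positivity
  push Not at h
  -- The available bound is a sum, not a product; on unit vectors it equals `N`, and homogeneity
  -- restores the product.
  set u : Fin N → EllP p := fun i => ((‖m i‖⁻¹ : ℝ) : ℂ) • m i
  have hu : ∀ i, ‖u i‖ = 1 := fun i => by
    rw [norm_smul, Complex.norm_real, norm_inv, norm_norm,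
      inv_mul_cancel₀ (norm_ne_zero_iff.2 (h i))]
  have hmu : m = fun i => ((‖m i‖ : ℝ) : ℂ) • u i := by
    funext i
    rw [smul_smul, ← Complex.ofReal_mul, mul_inv_cancel₀ (norm_ne_zero_iff.2 (h i)),
      Complex.ofReal_one, one_smul]
  have h1 : ‖powerSumForm hp hN hε u‖ ≤ N := by
    refine (summable_diagonal hp hN hε u).2.trans_eq ?_
    simp [hu]
  have h2 : powerSumForm hp hN hε m
      = (∏ i, ((‖m i‖ : ℝ) : ℂ)) • powerSumForm hp hN hε u := by
    conv_lhs => rw [hmu]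
    exact MultilinearMap.map_smul_univ _ _ _
  rw [h2, norm_smul, norm_prod, mul_comm]
  simp only [Complex.norm_real, norm_norm]
  gcongr

/-- The power sum polynomial as a member of `𝒜_u`. -/
def powerSumAu (hp : p ≠ ∞) {N : ℕ} (hN : p.toReal ≤ N) {ε : ℕ → ℂ} (hε : ∀ n, ‖ε n‖ ≤ 1) :
    Au (EllP p) := by
  let T : ContinuousMultilinearMap ℂ (fun _ : Fin N => EllP p) ℂ :=
    (powerSumForm hp hN hε).mkContinuous N (norm_powerSumForm_le hp hN hε)
  have hT : ∀ x : EllP p, powerSum ε N x = T fun _ => x := fun x => by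
    change _ = ∑' n, ε n * ∏ _i : Fin N, x n
    simp [powerSum]
  exact Au.mk (powerSum ε N)
    (by
      intro x _
      have : powerSum ε N = T ∘ fun x (_ : Fin N) => x := funext hT
      rw [this]
      exact T.analyticAt.comp ((ContinuousLinearMap.pi fun _ : Fin N =>
        ContinuousLinearMap.id ℂ (EllP p)).analyticAt x))
    (by
      have hL : ∀ x ∈ ball (0 : EllP p) 1, ∀ y ∈ ball (0 : EllP p) 1,
          dist (powerSum ε N x) (powerSum ε N y) ≤ (‖T‖₊ * N : NNReal) * dist x y := by
        intro x hx y hy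
        rw [mem_ball_zero_iff] at hx hy
        rw [dist_eq_norm, dist_eq_norm, hT, hT]
        have e := T.norm_image_sub_le (fun _ => x) (fun _ => y)
        have n1 : ∀ v : EllP p, ‖(fun _ : Fin N => v)‖ ≤ ‖v‖ := fun v =>
          (pi_norm_le_iff_of_nonneg (norm_nonneg v)).2 fun _ => le_rfl
        refine e.trans ?_
        have n2 : max ‖fun _ : Fin N => x‖ ‖fun _ : Fin N => y‖ ^ (Fintype.card (Fin N) - 1) ≤ 1 :=
          pow_le_one₀ (by positivity) (max_le ((n1 x).trans hx.le) ((n1 y).trans hy.le))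
        have n3 := n1 (x - y)
        rw [Fintype.card_fin] at n2 ⊢
        push_cast
        calc _ ≤ ‖T‖ * N * 1 * ‖x - y‖ := by gcongr; exact n3
          _ = _ := by rw [mul_one]
      exact (LipschitzOnWith.of_dist_le_mul hL).uniformContinuousOn)
    1
    (by
      intro x hx
      have := norm_powerSum_le hp hN hε (M := 0) (by simp) x
      refine this.trans ?_
      rw [mem_ball_zero_iff] at hx
      rw [Finset.range_zero, Finset.sum_empty, sub_zero]
      have hr := toReal_pos_of_fact hp
      exact Real.rpow_le_one (by positivity)
        (Real.rpow_le_one (norm_nonneg _) hx.le hr.le) (by positivity))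

theorem powerSumAu_apply (hp : p ≠ ∞) {N : ℕ} (hN : p.toReal ≤ N) {ε : ℕ → ℂ}
    (hε : ∀ n, ‖ε n‖ ≤ 1) (x : ball (0 : EllP p) 1) :
    (powerSumAu hp hN hε : ball (0 : EllP p) 1 →ᵇ ℂ) x = powerSum ε N (x : EllP p) := rfl

theorem continuous_powerSum (hp : p ≠ ∞) {N : ℕ} (hN : p.toReal ≤ N) {ε : ℕ → ℂ}
    (hε : ∀ n, ‖ε n‖ ≤ 1) : Continuous (powerSum ε N : EllP p → ℂ) := by
  have hT : (powerSum ε N : EllP p → ℂ) = fun x =>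
      (powerSumForm hp hN hε).mkContinuous N (norm_powerSumForm_le hp hN hε) fun _ => x := by
    funext x
    change _ = ∑' n, ε n * ∏ _i : Fin N, x n
    simp [powerSum]
  rw [hT]
  exact (ContinuousMultilinearMap.cont _).comp (continuous_pi fun _ => continuous_id)

end PowerSum

/-! ### Peak functions and their values at characters. -/

section Peak

variable {p : ℝ≥0∞}

theorem one_lt_toReal (hp1 : 1 < p) (hp : p ≠ ∞) : 1 < p.toReal := by
  simpa using (ENNReal.toReal_lt_toReal ENNReal.one_ne_top hp).2 hp1

theorem powerSum_testPoint {N : ℕ} (hN : N ≠ 0) (ε : ℕ → ℂ) (z : EllP p) (n : ℕ) :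
    powerSum ε N (testPoint z n) = powerSum ε N (truncation z n) + ε n * (gap z : ℂ) ^ N := by
  rw [powerSum, powerSum, tsum_eq_sum (s := Finset.range (n + 1)),
    tsum_eq_sum (s := Finset.range n), Finset.sum_range_succ]
  · congr 1
    · refine Finset.sum_congr rfl fun i hi => ?_
      rw [Finset.mem_range] at hi
      rw [testPoint_apply, truncation_apply, if_pos hi, if_pos hi]
    · rw [testPoint_apply, if_neg (lt_irrefl n), if_pos rfl]
  · intro i hi
    rw [Finset.mem_range] at hi
    rw [truncation_apply, if_neg hi, zero_pow hN, mul_zero]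
  · intro i hi
    rw [Finset.mem_range] at hi
    rw [testPoint_apply, if_neg (by omega), if_neg (by omega), zero_pow hN, mul_zero]

variable [Fact (1 ≤ p)]

theorem one_sub_norm_rpow_pos (hp : p ≠ ∞) {z : EllP p} (hz : ‖z‖ < 1) :
    0 < 1 - ‖z‖ ^ p.toReal :=
  sub_pos.2 (Real.rpow_lt_one (norm_nonneg _) hz (toReal_pos_of_fact hp))

theorem gap_pos (hp : p ≠ ∞) {z : EllP p} (hz : ‖z‖ < 1) : 0 < gap z :=
  Real.rpow_pos_of_pos (one_sub_norm_rpow_pos hp hz) _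

theorem gap_pow (hp : p ≠ ∞) {z : EllP p} (hz : ‖z‖ < 1) (N : ℕ) :
    gap z ^ N = (1 - ‖z‖ ^ p.toReal) ^ (N / p.toReal) := by
  rw [gap, ← Real.rpow_natCast, ← Real.rpow_mul (one_sub_norm_rpow_pos hp hz).le, one_div,
    div_eq_inv_mul]

/-- The sequence `ε` with its first `M` terms replaced by zero. -/
def tailSeq (ε : ℕ → ℂ) (M n : ℕ) : ℂ := if n < M then 0 else ε n

theorem norm_tailSeq_le {ε : ℕ → ℂ} (hε : ∀ n, ‖ε n‖ ≤ 1) (M n : ℕ) : ‖tailSeq ε M n‖ ≤ 1 := by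
  rw [tailSeq]
  split_ifs
  · simp
  · exact hε n

/-- The constant `N / (p * s ^ p)`. -/
def peakRate (N : ℕ) (z : EllP p) : ℝ := N / (p.toReal * (1 - ‖z‖ ^ p.toReal))

/-- The functional `x ↦ ∑ i < M, κ * p * J (y i) * x i`, where `κ = peakRate N z` and `J` is the
duality map. -/
def peakFunctional (N : ℕ) (z : EllP p) (y : ℕ → ℂ) (M : ℕ) : StrongDual ℂ (EllP p) :=
  ∑ i ∈ Finset.range M,
    (((peakRate N z * p.toReal : ℝ) : ℂ) * dualityMap p.toReal (y i)) • coord p i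

/-- The normalizing constant of `peakAu`. -/
def peakConst (N : ℕ) (z : EllP p) (y : ℕ → ℂ) (M : ℕ) : ℝ :=
  (gap z ^ N)⁻¹ * Real.exp (-(peakRate N z *
    (‖z‖ ^ p.toReal + (p.toReal - 1) * ∑ i ∈ Finset.range M, ‖y i‖ ^ p.toReal)))

/-- A function in the unit ball of `𝒜_u(B_{ℓ_p})` which, for `y = z` and `ε` of modulus one, nearly
attains its norm at `testPoint z n` for all large `n`. -/
def peakAu (hp : p ≠ ∞) {N : ℕ} (hN : p.toReal ≤ N) {ε : ℕ → ℂ} (hε : ∀ n, ‖ε n‖ ≤ 1)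
    (z : EllP p) (y : ℕ → ℂ) (M : ℕ) : Au (EllP p) :=
  (peakConst N z y M : ℂ) •
    (expDual (peakFunctional N z y M) * powerSumAu hp hN (norm_tailSeq_le hε M))

theorem norm_peakAu_le (hp1 : 1 < p) (hp : p ≠ ∞) {N : ℕ} (hN : p.toReal ≤ N) {ε : ℕ → ℂ}
    (hε : ∀ n, ‖ε n‖ ≤ 1) {z : EllP p} (hz : ‖z‖ < 1) (y : ℕ → ℂ) (M : ℕ) :
    ‖peakAu hp hN hε z y M‖ ≤ 1 := by
  refine Au.norm_le zero_le_one fun x => ?_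
  have hval : (peakAu hp hN hε z y M : ball (0 : EllP p) 1 →ᵇ ℂ) x = (peakConst N z y M : ℂ) *
      (Complex.exp (peakFunctional N z y M x) * powerSum (tailSeq ε M) N (x : EllP p)) := rfl
  have hr := one_lt_toReal hp1 hp
  have hθ := one_sub_norm_rpow_pos hp hz
  have hs := gap_pos hp hz
  have hx : ‖(x : EllP p)‖ ^ p.toReal ≤ 1 :=
    Real.rpow_le_one (norm_nonneg _) (mem_ball_zero_iff.1 x.2).le (by linarith)
  have hG := norm_powerSum_le hp hN (norm_tailSeq_le hε M) (M := M) (fun n hn => if_pos hn)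
    (x : EllP p)
  have hb0 := (hasSum_tail_norm_rpow hp M (x : EllP p)).nonneg
    (fun n => by split_ifs <;> positivity)
  set b := ‖(x : EllP p)‖ ^ p.toReal - ∑ i ∈ Finset.range M, ‖(x : EllP p) i‖ ^ p.toReal
  set r := p.toReal
  set θ := ‖z‖ ^ r
  set κ := peakRate N z
  have hκ : κ = N / (r * (1 - θ)) := rfl
  have hκ0 : 0 ≤ κ := by rw [hκ]; positivity
  -- Raise `1 + u ≤ exp u`, with `u = b / s^p - 1`, to the power `N / p`. Equality holds at `b =
  -- s^p`, the mass that the test points place in the extra coordinate; this dictates `κ`.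
  have hG2 : ‖powerSum (tailSeq ε M) N (x : EllP p)‖
      ≤ gap z ^ N * Real.exp (κ * (b - (1 - θ))) := by
    refine hG.trans ?_
    have e1 : b = (1 - θ) * (b / (1 - θ)) := by field_simp
    have e2 : κ * (b - (1 - θ)) = (b / (1 - θ) - 1) * (N / r) := by rw [hκ]; field_simp
    rw [gap_pow hp hz, e2, Real.exp_mul]
    conv_lhs => rw [e1]
    rw [Real.mul_rpow hθ.le (by positivity)]
    gcongr
    have := Real.add_one_le_exp (b / (1 - θ) - 1)
    linarith
  have hre : (peakFunctional N z y M x).re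
      = κ * ∑ i ∈ Finset.range M, r * (dualityMap r (y i) * (x : EllP p) i).re := by
    rw [peakFunctional, sum_apply, Complex.re_sum, Finset.mul_sum]
    refine Finset.sum_congr rfl fun i _ => ?_
    rw [smul_apply, coord_apply, smul_eq_mul, mul_assoc,
      Complex.re_ofReal_mul, mul_assoc]
  have hY : ∑ i ∈ Finset.range M, r * (dualityMap r (y i) * (x : EllP p) i).re
      ≤ ∑ i ∈ Finset.range M, ‖(x : EllP p) i‖ ^ r
        + (r - 1) * ∑ i ∈ Finset.range M, ‖y i‖ ^ r := by
    rw [Finset.mul_sum, ← Finset.sum_add_distrib]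
    exact Finset.sum_le_sum fun i _ => young_dualityMap hr _ _
  rw [hval, norm_mul, norm_mul, Complex.norm_exp, Complex.norm_real, hre, Real.norm_of_nonneg
    (by rw [peakConst]; positivity), peakConst]
  calc _ ≤ (gap z ^ N)⁻¹ * Real.exp (-(κ * (θ + (r - 1) * ∑ i ∈ Finset.range M, ‖y i‖ ^ r))) *
        (Real.exp (κ * ∑ i ∈ Finset.range M, r * (dualityMap r (y i) * (x : EllP p) i).re) *
          (gap z ^ N * Real.exp (κ * (b - (1 - θ))))) := by gcongr
    _ = Real.exp (κ * (b - (1 - θ) - (θ + (r - 1) * ∑ i ∈ Finset.range M, ‖y i‖ ^ r) +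
          ∑ i ∈ Finset.range M, r * (dualityMap r (y i) * (x : EllP p) i).re)) := by
        have e : κ * (b - (1 - θ) - (θ + (r - 1) * ∑ i ∈ Finset.range M, ‖y i‖ ^ r) +
          ∑ i ∈ Finset.range M, r * (dualityMap r (y i) * (x : EllP p) i).re)
          = -(κ * (θ + (r - 1) * ∑ i ∈ Finset.range M, ‖y i‖ ^ r)) +
            κ * ∑ i ∈ Finset.range M, r * (dualityMap r (y i) * (x : EllP p) i).re +
            κ * (b - (1 - θ)) := by ring
        rw [e, Real.exp_add, Real.exp_add]
        field_simp
    _ ≤ 1 := by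
        -- By Young the terms in `y` cancel, and the bracket is at most `‖x‖ ^ p - 1 ≤ 0`.
        refine Real.exp_le_one_iff.2 (mul_nonpos_of_nonneg_of_nonpos hκ0 ?_)
        simp only [b]
        linarith

theorem Spectrum.apply_peakAu (φ : Spectrum (EllP p)) (hp : p ≠ ∞) {N : ℕ} (hN : p.toReal ≤ N)
    {ε : ℕ → ℂ} (hε : ∀ n, ‖ε n‖ ≤ 1) (z : EllP p) (y : ℕ → ℂ) (M : ℕ) :
    φ (peakAu hp hN hε z y M) = peakConst N z y M *
      (Complex.exp (∑ i ∈ Finset.range M, ((peakRate N z * p.toReal : ℝ) : ℂ) *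
        (dualityMap p.toReal (y i) * φ (ofDual (coord p i)))) *
      φ (powerSumAu hp hN (norm_tailSeq_le hε M))) := by
  rw [peakAu, map_smul, map_mul, φ.apply_expDual, peakFunctional, ofDual_sum, map_sum,
    smul_eq_mul]
  simp only [ofDual_smul, map_smul, smul_eq_mul, mul_assoc]

variable {z : EllP p} {U : Ultrafilter ℕ} {φ : Spectrum (EllP p)}

theorem tendsto_testPoint {hp : p ≠ ∞} {hz : ‖z‖ ≤ 1} (hφ : Tendsto (deltaSeq hp z hz) U (𝓝 φ))
    {f : Au (EllP p)} {F : EllP p → ℂ} (hF : Continuous F)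
    (hf : ∀ x, (f : ball (0 : EllP p) 1 →ᵇ ℂ) x = F x) :
    Tendsto (fun n => F (testPoint z n)) U (𝓝 (φ f)) := by
  refine (((Spectrum.continuous_eval f).tendsto φ).comp hφ).congr fun n => ?_
  exact extend_eq_of_continuousAt f hf (norm_testPoint_le hp z hz n) hF.continuousAt

theorem apply_coord_of_tendsto (hU : ↑U ≤ (atTop : Filter ℕ)) {hp : p ≠ ∞} {hz : ‖z‖ ≤ 1}
    (hφ : Tendsto (deltaSeq hp z hz) U (𝓝 φ)) (i : ℕ) : φ (ofDual (coord p i)) = z i := by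
  refine tendsto_nhds_unique (tendsto_testPoint hφ (coord p i).continuous fun _ => rfl)
    (tendsto_const_nhds.congr' ?_)
  filter_upwards [hU (eventually_gt_atTop i)] with n hn
  rw [coord_apply, testPoint_apply, if_pos hn]

/-- At a test point with `n ≥ M` the extra coordinate contributes exactly `ε_n s^N`; the rest is a
power sum over coordinates of `z` beyond `M`, bounded by the tail mass of `z`. -/
theorem norm_apply_powerSumAu_sub_le (hU : ↑U ≤ (atTop : Filter ℕ)) {hp : p ≠ ∞} {hz : ‖z‖ ≤ 1}
    (hφ : Tendsto (deltaSeq hp z hz) U (𝓝 φ)) {N : ℕ} (hN : p.toReal ≤ N) {ε : ℕ → ℂ}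
    (hε : ∀ n, ‖ε n‖ ≤ 1) {e : ℂ} (he : ∀ᶠ n in U, ε n = e) (M : ℕ) :
    ‖φ (powerSumAu hp hN (norm_tailSeq_le hε M)) - e * (gap z : ℂ) ^ N‖ ≤
      (‖z‖ ^ p.toReal - ∑ i ∈ Finset.range M, ‖z i‖ ^ p.toReal) ^ (N / p.toReal) := by
  have hr := toReal_pos_of_fact hp
  have hN0 : N ≠ 0 := by
    have : 0 < N := by exact_mod_cast hr.trans_le hN
    exact this.ne'
  have h1 := (tendsto_testPoint hφ (continuous_powerSum hp hN (norm_tailSeq_le hε M))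
    (powerSumAu_apply hp hN (norm_tailSeq_le hε M))).sub_const (e * (gap z : ℂ) ^ N)
  refine le_of_tendsto h1.norm ?_
  filter_upwards [hU (eventually_ge_atTop M), he] with n hn hen
  have h2 : tailSeq ε M n = e := by rw [tailSeq, if_neg hn.not_gt, hen]
  rw [powerSum_testPoint hN0, h2, add_sub_cancel_right]
  refine (norm_powerSum_le hp hN (norm_tailSeq_le hε M) (M := M) (fun n hn => if_pos hn) _).trans ?_
  have h3 : ∑ i ∈ Finset.range M, ‖truncation z n i‖ ^ p.toReal
      = ∑ i ∈ Finset.range M, ‖z i‖ ^ p.toReal :=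
    Finset.sum_congr rfl fun i hi => by
      rw [truncation_apply, if_pos ((Finset.mem_range.1 hi).trans_le hn)]
  have h4 : ‖truncation z n‖ ^ p.toReal ≤ ‖z‖ ^ p.toReal := by
    rw [truncation, lp.norm_sum_single hr]
    exact lp.sum_rpow_le_norm_rpow hr z _
  have h5 := (hasSum_tail_norm_rpow hp M (truncation z n)).nonneg
    (fun n => by split_ifs <;> positivity)
  rw [h3] at h5 ⊢
  exact Real.rpow_le_rpow h5 (by linarith) (by positivity)

/-- The peak functions for `y = z` converge at an accumulation point `φ` to the eventual value of
`ε`. -/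
theorem tendsto_apply_peakAu (hp1 : 1 < p) (hU : ↑U ≤ (atTop : Filter ℕ)) {hp : p ≠ ∞}
    (hz : ‖z‖ < 1) (hφ : Tendsto (deltaSeq hp z hz.le) U (𝓝 φ)) {N : ℕ} (hN : p.toReal ≤ N)
    {ε : ℕ → ℂ} (hε : ∀ n, ‖ε n‖ ≤ 1) {e : ℂ} (he : ∀ᶠ n in U, ε n = e) :
    Tendsto (fun M => φ (peakAu hp hN hε z z M)) atTop (𝓝 e) := by
  have hr := one_lt_toReal hp1 hp
  have hN0 : (0 : ℝ) < N := by linarith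
  have hs := gap_pos hp hz
  have hS := (lp.hasSum_norm (toReal_pos_of_fact hp) z).tendsto_sum_nat
  have hG : Tendsto (fun M => φ (powerSumAu hp hN (norm_tailSeq_le hε M))) atTop
      (𝓝 (e * (gap z : ℂ) ^ N)) := by
    rw [tendsto_iff_norm_sub_tendsto_zero]
    refine squeeze_zero (fun M => norm_nonneg _)
      (norm_apply_powerSumAu_sub_le hU hφ hN hε he) ?_
    have := (hS.const_sub (‖z‖ ^ p.toReal)).rpow_const (p := N / p.toReal) (Or.inr (by positivity))
    rwa [sub_self, Real.zero_rpow (by positivity)] at this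
  -- Since `φ` has coordinates `z_i`, each `J(z_i) z_i` is `|z_i| ^ p`; only the tail mass of `z`
  -- survives in the exponent.
  have hE : ∀ M, (peakConst N z z M : ℂ) *
      Complex.exp (∑ i ∈ Finset.range M, ((peakRate N z * p.toReal : ℝ) : ℂ) *
        (dualityMap p.toReal (z i) * φ (ofDual (coord p i))))
      = (((gap z ^ N)⁻¹ * Real.exp (peakRate N z *
        (∑ i ∈ Finset.range M, ‖z i‖ ^ p.toReal - ‖z‖ ^ p.toReal)) : ℝ) : ℂ) := by
    intro M
    have : ∑ i ∈ Finset.range M, ((peakRate N z * p.toReal : ℝ) : ℂ) *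
        (dualityMap p.toReal (z i) * φ (ofDual (coord p i)))
        = ((peakRate N z * p.toReal * ∑ i ∈ Finset.range M, ‖z i‖ ^ p.toReal : ℝ) : ℂ) := by
      rw [← Finset.mul_sum, Complex.ofReal_mul (peakRate N z * p.toReal), Complex.ofReal_sum]
      congr 1
      refine Finset.sum_congr rfl fun i _ => ?_
      rw [apply_coord_of_tendsto hU hφ, dualityMap_mul_self hr]
    rw [this, ← Complex.ofReal_exp, ← Complex.ofReal_mul, peakConst, mul_assoc, ← Real.exp_add]
    congr 4
    ring
  have hC : Tendsto (fun M => (gap z ^ N)⁻¹ * Real.exp (peakRate N z *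
        (∑ i ∈ Finset.range M, ‖z i‖ ^ p.toReal - ‖z‖ ^ p.toReal))) atTop
      (𝓝 (gap z ^ N)⁻¹) := by
    have := ((Real.continuous_exp.tendsto _).comp
      ((hS.sub_const (‖z‖ ^ p.toReal)).const_mul (peakRate N z))).const_mul (gap z ^ N)⁻¹
    rw [sub_self, mul_zero, Real.exp_zero, mul_one] at this
    exact this
  have hlim := ((Complex.continuous_ofReal.tendsto _).comp hC).mul hG
  have e1 : (((gap z ^ N)⁻¹ : ℝ) : ℂ) * (e * (gap z : ℂ) ^ N) = e := by
    have : (gap z : ℂ) ≠ 0 := Complex.ofReal_ne_zero.2 hs.ne'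
    push_cast
    field_simp
  rw [e1] at hlim
  refine hlim.congr fun M => ?_
  rw [φ.apply_peakAu, ← mul_assoc, hE]
  rfl

/-- Isolates the dependence on `y` as a product over coordinates, so that changing one `y_j` alters
a single factor. -/
theorem Spectrum.norm_apply_peakAu (ψ : Spectrum (EllP p)) (hp : p ≠ ∞) {N : ℕ}
    (hN : p.toReal ≤ N) {ε : ℕ → ℂ} (hε : ∀ n, ‖ε n‖ ≤ 1) (z : EllP p) (y : ℕ → ℂ) (M : ℕ) :
    ‖ψ (peakAu hp hN hε z y M)‖ = Real.exp (peakRate N z * ∑ i ∈ Finset.range M,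
        (p.toReal * (dualityMap p.toReal (y i) * ψ (ofDual (coord p i))).re
          - (p.toReal - 1) * ‖y i‖ ^ p.toReal)) *
      (‖(gap z ^ N)⁻¹‖ * Real.exp (-(peakRate N z * ‖z‖ ^ p.toReal)) *
        ‖ψ (powerSumAu hp hN (norm_tailSeq_le hε M))‖) := by
  have h1 : (∑ i ∈ Finset.range M, ((peakRate N z * p.toReal : ℝ) : ℂ) *
        (dualityMap p.toReal (y i) * ψ (ofDual (coord p i)))).re
      = peakRate N z * ∑ i ∈ Finset.range M,
        p.toReal * (dualityMap p.toReal (y i) * ψ (ofDual (coord p i))).re := by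
    rw [Complex.re_sum, Finset.mul_sum]
    refine Finset.sum_congr rfl fun i _ => ?_
    rw [Complex.re_ofReal_mul, mul_assoc]
  have h2 : peakRate N z * ∑ i ∈ Finset.range M,
        (p.toReal * (dualityMap p.toReal (y i) * ψ (ofDual (coord p i))).re
          - (p.toReal - 1) * ‖y i‖ ^ p.toReal) + -(peakRate N z * ‖z‖ ^ p.toReal)
      = -(peakRate N z * (‖z‖ ^ p.toReal + (p.toReal - 1) *
          ∑ i ∈ Finset.range M, ‖y i‖ ^ p.toReal)) + peakRate N z * ∑ i ∈ Finset.range M,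
        p.toReal * (dualityMap p.toReal (y i) * ψ (ofDual (coord p i))).re := by
    rw [Finset.sum_sub_distrib, ← Finset.mul_sum _ _ (p.toReal - 1)]
    ring
  have h3 := congrArg Real.exp h2
  rw [Real.exp_add, Real.exp_add] at h3
  rw [ψ.apply_peakAu, norm_mul, norm_mul, Complex.norm_exp, h1, peakConst, Complex.norm_real,
    norm_mul, Real.norm_of_nonneg (Real.exp_nonneg _)]
  linear_combination (-(‖(gap z ^ N)⁻¹‖ *
    ‖ψ (powerSumAu hp hN (norm_tailSeq_le hε M))‖)) * h3

theorem sum_range_update (a : ℕ → ℂ → ℝ) (y : ℕ → ℂ) (w : ℂ) {j M : ℕ} (hj : j < M) :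
    ∑ i ∈ Finset.range M, a i (Function.update y j w i)
      = (a j w - a j (y j)) + ∑ i ∈ Finset.range M, a i (y i) := by
  have hjM : j ∈ Finset.range M := Finset.mem_range.2 hj
  rw [← Finset.add_sum_erase _ _ hjM, ← Finset.add_sum_erase _ (fun i => a i (y i)) hjM,
    Function.update_self, Finset.sum_congr rfl fun i hi => by
      rw [Function.update_of_ne (Finset.ne_of_mem_erase hi)]]
  ring

/-- Replacing one coordinate of `y` multiplies the value of the peak function at `ψ` by an explicit
factor. -/
theorem Spectrum.norm_apply_peakAu_update (ψ : Spectrum (EllP p)) (hp1 : 1 < p) (hp : p ≠ ∞)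
    {N : ℕ} (hN : p.toReal ≤ N) {ε : ℕ → ℂ} (hε : ∀ n, ‖ε n‖ ≤ 1) (z : EllP p) (y : ℕ → ℂ)
    {j M : ℕ} (hj : j < M) :
    ‖ψ (peakAu hp hN hε z (Function.update y j (ψ (ofDual (coord p j)))) M)‖
      = Real.exp (peakRate N z * (‖ψ (ofDual (coord p j))‖ ^ p.toReal
          + (p.toReal - 1) * ‖y j‖ ^ p.toReal
          - p.toReal * (dualityMap p.toReal (y j) * ψ (ofDual (coord p j))).re)) *
        ‖ψ (peakAu hp hN hε z y M)‖ := by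
  rw [ψ.norm_apply_peakAu, ψ.norm_apply_peakAu, ← mul_assoc (Real.exp _) (Real.exp _),
    ← Real.exp_add, ← mul_add, sum_range_update (fun i v => p.toReal *
      (dualityMap p.toReal v * ψ (ofDual (coord p i))).re - (p.toReal - 1) * ‖v‖ ^ p.toReal) y _ hj,
    dualityMap_mul_self (one_lt_toReal hp1 hp), Complex.ofReal_re]
  congr 4
  ring

/-- Gleason parts of accumulation points are contained in the fiber over `z`. -/
theorem gleasonPart_subset_fiber (hp1 : 1 < p) (hp : p ≠ ∞) (hz : ‖z‖ < 1)
    (hφ : φ ∈ wstarAcc (deltaSeq hp z hz.le)) :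
    gleasonPart φ ⊆ fiber (NormedSpace.inclusionInDoubleDual ℂ (EllP p) z) := by
  obtain ⟨U, hU, hlim⟩ := mem_wstarAcc_iff.1 hφ
  intro ψ hψ
  have hr := one_lt_toReal hp1 hp
  obtain ⟨N, hN⟩ := exists_nat_ge p.toReal
  have hε : ∀ n : ℕ, ‖(fun _ => 1 : ℕ → ℂ) n‖ ≤ 1 := fun _ => by simp
  have hκ : 0 < peakRate N z := by
    have : (0 : ℝ) < N := by linarith
    have := one_sub_norm_rpow_pos hp hz
    rw [peakRate]
    positivity
  have hψ1 := tendsto_one_of_mem_gleasonPart hψ (fun M => norm_peakAu_le hp1 hp hN hε hz z M)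
    (tendsto_apply_peakAu hp1 hU hz hlim hN hε (Eventually.of_forall fun _ => rfl))
  have hcoord : ∀ j, ψ (ofDual (coord p j)) = z j := by
    intro j
    refine eq_of_le_young_dualityMap hr ?_
    -- The deficit in Young's inequality. The modified peak function still has norm at most one,
    -- while its value at `ψ` has modulus tending to `exp (κ E)`, so `E ≤ 0`.
    set E := ‖ψ (ofDual (coord p j))‖ ^ p.toReal + (p.toReal - 1) * ‖z j‖ ^ p.toReal
          - p.toReal * (dualityMap p.toReal (z j) * ψ (ofDual (coord p j))).re
    have h1 : Tendsto (fun M => Real.exp (peakRate N z * E) * ‖ψ (peakAu hp hN hε z z M)‖) atTop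
        (𝓝 (Real.exp (peakRate N z * E))) := by
      simpa using hψ1.norm.const_mul (Real.exp (peakRate N z * E))
    have h2 : Real.exp (peakRate N z * E) ≤ 1 := by
      refine le_of_tendsto h1 ?_
      filter_upwards [eventually_gt_atTop j] with M hM
      rw [← ψ.norm_apply_peakAu_update hp1 hp hN hε z z hM]
      exact (ψ.norm_apply_le _).trans (norm_peakAu_le hp1 hp hN hε hz _ M)
    have h3 : E ≤ 0 := by
      have := Real.exp_le_one_iff.1 h2
      by_contra! h
      exact absurd this (mul_pos hκ h).not_ge
    exact sub_nonpos.1 h3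
  intro L
  rw [NormedSpace.dual_def]
  -- Agreement on coordinates passes to every functional by norm density.
  have hL := tendsto_sum_coord hp1 hp L
  have hLψ : Tendsto (fun M => ψ (ofDual (∑ i ∈ Finset.range M, L (lp.single p i 1) • coord p i)))
      atTop (𝓝 (ψ (ofDual L))) := by
    rw [tendsto_iff_norm_sub_tendsto_zero] at hL ⊢
    refine squeeze_zero (fun _ => norm_nonneg _) (fun M => ?_) hL
    rw [← map_sub, ← ofDual_sub]
    exact (ψ.norm_apply_le _).trans (norm_ofDual_le _)
  have hLz := ((ContinuousLinearMap.apply ℂ ℂ z).continuous.tendsto L).comp hL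
  refine tendsto_nhds_unique hLψ (hLz.congr fun M => ?_)
  rw [Function.comp, ofDual_sum, map_sum, map_sum]
  refine Finset.sum_congr rfl fun i _ => ?_
  rw [ofDual_smul, map_smul, map_smul, hcoord]
  rfl

/-- The function equal to `1` on `A` and to `-1` off `A`. -/
def signSeq (A : Set ℕ) (n : ℕ) : ℂ := by
  classical exact if n ∈ A then 1 else -1

theorem norm_signSeq_le (A : Set ℕ) (n : ℕ) : ‖signSeq A n‖ ≤ 1 := by
  rw [signSeq]
  split_ifs <;> simp

/-- Limits along different ultrafilters lie in disjoint Gleason parts. -/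
theorem disjoint_gleasonPart_of_mem (hp1 : 1 < p) {hp : p ≠ ∞} (hz : ‖z‖ < 1)
    (hU : ↑U ≤ (atTop : Filter ℕ)) (hφ : Tendsto (deltaSeq hp z hz.le) U (𝓝 φ))
    {V : Ultrafilter ℕ} {φ' : Spectrum (EllP p)} (hV : ↑V ≤ (atTop : Filter ℕ))
    (hφ' : Tendsto (deltaSeq hp z hz.le) V (𝓝 φ')) {A : Set ℕ} (hA : A ∈ U) (hA' : Aᶜ ∈ V) :
    Disjoint (gleasonPart φ) (gleasonPart φ') := by
  obtain ⟨N, hN⟩ := exists_nat_ge p.toReal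
  refine disjoint_gleasonPart
    (fun M => norm_peakAu_le hp1 hp hN (norm_signSeq_le A) hz z M)
    (tendsto_apply_peakAu hp1 hU hz hφ hN (norm_signSeq_le A) ?_)
    (tendsto_apply_peakAu hp1 hV hz hφ' hN (norm_signSeq_le A) ?_)
  · filter_upwards [hA] with n hn
    exact if_pos hn
  · filter_upwards [hA'] with n hn
    exact if_neg hn

/-- Distinct limits come from distinct ultrafilters, and some set `A` belongs to one and its
complement to the other. -/
theorem pairwiseDisjoint_gleasonPart (hp1 : 1 < p) (hp : p ≠ ∞) (hz : ‖z‖ < 1) :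
    (wstarAcc (deltaSeq hp z hz.le)).PairwiseDisjoint gleasonPart := by
  intro φ hφ φ' hφ' hne
  obtain ⟨U, hU, hlim⟩ := mem_wstarAcc_iff.1 hφ
  obtain ⟨V, hV, hlim'⟩ := mem_wstarAcc_iff.1 hφ'
  have hUV : U ≠ V := by
    rintro rfl
    exact hne (tendsto_nhds_unique hlim hlim')
  obtain ⟨A, hA, hA'⟩ : ∃ A ∈ U, A ∉ V := by
    by_contra! h
    exact hUV (Ultrafilter.coe_le_coe.1 h).symm
  exact disjoint_gleasonPart_of_mem hp1 hz hU hlim hV hlim' hA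
    (Ultrafilter.compl_mem_iff_notMem.2 hA')

end Peak

/-! ### Independent families and cardinalities. -/

section Cardinality

/-- The trace of a set of natural numbers on `{0, …, k - 1}`. -/
def trace (X : Set ℕ) (k : ℕ) : Finset ℕ := by
  classical exact (Finset.range k).filter (· ∈ X)

theorem mem_trace {X : Set ℕ} {k i : ℕ} : i ∈ trace X k ↔ i < k ∧ i ∈ X := by
  simp [trace]

theorem eventually_trace_eq_iff (X Y : Set ℕ) :
    ∀ᶠ k in atTop, (trace X k = trace Y k ↔ X = Y) := by
  by_cases h : X = Y
  · simp [h]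
  · obtain ⟨i, hi⟩ : ∃ i, ¬(i ∈ X ↔ i ∈ Y) := by
      by_contra! hh
      exact h (Set.ext hh)
    filter_upwards [eventually_gt_atTop i] with k hk
    refine iff_of_false (fun e => hi ?_) h
    have := Finset.ext_iff.1 e i
    simpa only [mem_trace, hk, true_and] using this

/-- Hausdorff's independent family of subsets of a countable set, indexed by all sets of natural
numbers: any choice of members and complements of members is contained in a free ultrafilter. -/
theorem exists_independent_family : ∃ A : Set ℕ → Set ℕ, ∀ g : Set (Set ℕ), ∃ U : Ultrafilter ℕ,
    ↑U ≤ (atTop : Filter ℕ) ∧ ∀ X, (X ∈ g → A X ∈ U) ∧ (X ∉ g → (A X)ᶜ ∈ U) := by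
  classical
  let e : ℕ ≃ ℕ × Finset (Finset ℕ) := (Denumerable.eqv _).symm
  -- Integers code pairs (length, family of finite sets); `A X` collects the pairs whose family
  -- contains the trace of `X` at that length.
  let A : Set ℕ → Set ℕ := fun X => {n | trace X (e n).1 ∈ (e n).2}
  refine ⟨A, fun g => ?_⟩
  let B : Set ℕ → Set ℕ := fun X => if X ∈ g then A X else (A X)ᶜ
  have hinf : ∀ t : Set (Set ℕ), t.Finite → (⋂ X ∈ t, B X).Infinite := by
    intro t ht
    have hsep : ∀ᶠ k in atTop, ∀ X ∈ t, ∀ Y ∈ t, (trace X k = trace Y k ↔ X = Y) :=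
      (eventually_all_finite ht).2 fun X _ => (eventually_all_finite ht).2 fun Y _ =>
        eventually_trace_eq_iff X Y
    obtain ⟨k, hk⟩ := eventually_atTop.1 hsep
    -- Beyond length `k` the members of `t` have distinct traces, so listing the traces of those in
    -- `g` realizes the prescribed pattern, once for each length.
    let S : ℕ → Finset (Finset ℕ) := fun n =>
      (ht.toFinset.filter (· ∈ g)).image fun X => trace X (k + n)
    have hinj : Function.Injective fun n => e.symm (k + n, S n) := by
      intro m n h
      have := congrArg Prod.fst (e.symm.injective h)
      simpa using this
    refine Set.infinite_of_injective_forall_mem hinj fun n => ?_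
    rw [Set.mem_iInter₂]
    intro X hX
    have hA : e.symm (k + n, S n) ∈ A X ↔ X ∈ g := by
      simp only [A, S, Set.mem_ofPred_eq, Equiv.apply_symm_apply, Finset.mem_image,
        Finset.mem_filter, Set.Finite.mem_toFinset]
      constructor
      · rintro ⟨Y, ⟨hY, hYg⟩, hYX⟩
        rwa [← (hk (k + n) (Nat.le_add_right _ _) Y hY X hX).1 hYX]
      · exact fun h => ⟨X, ⟨hX, h⟩, rfl⟩
    by_cases hg : X ∈ g
    · simpa only [B, if_pos hg] using hA.2 hg
    · simpa only [B, if_neg hg, Set.mem_compl_iff] using fun h => hg (hA.1 h)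
  have hne : NeBot (atTop ⊓ ⨅ X, 𝓟 (B X) : Filter ℕ) := by
    rw [inf_neBot_iff]
    intro s hs s' hs'
    obtain ⟨t, ht, hts⟩ := (hasBasis_iInf_principal_finite B).mem_iff.1 hs'
    rw [← Nat.cofinite_eq_atTop, mem_cofinite] at hs
    obtain ⟨n, hn, hns⟩ := ((hinf t ht).sdiff hs).nonempty
    exact ⟨n, not_not.1 hns, hts hn⟩
  refine ⟨Ultrafilter.of (atTop ⊓ ⨅ X, 𝓟 (B X)), (Ultrafilter.of_le _).trans inf_le_left,
    fun X => ?_⟩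
  have hB : B X ∈ Ultrafilter.of (atTop ⊓ ⨅ X, 𝓟 (B X)) :=
    (Ultrafilter.of_le _).trans (inf_le_right.trans (iInf_le _ X)) (mem_principal_self _)
  exact ⟨fun h => by simpa only [B, if_pos h] using hB,
    fun h => by simpa only [B, if_neg h] using hB⟩

variable {p : ℝ≥0∞} [Fact (1 ≤ p)] {z : EllP p}

theorem mk_spectrum_ellP_le (hp : p ≠ ∞) : #(Spectrum (EllP p)) ≤ 2 ^ 𝔠 :=
  haveI := separableSpace_ellP (p := p) hp
  mk_spectrum_le

theorem mk_wstarAcc_deltaSeq (hp1 : 1 < p) (hp : p ≠ ∞) (hz : ‖z‖ < 1) :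
    #(wstarAcc (deltaSeq hp z hz.le)) = 2 ^ 𝔠 := by
  refine le_antisymm ((mk_set_le _).trans (mk_spectrum_ellP_le hp)) ?_
  obtain ⟨A, hA⟩ := exists_independent_family
  choose U hU hUA using hA
  choose φ hφ hlim using fun g => exists_mem_wstarAcc (deltaSeq hp z hz.le) (hU g)
  -- `A X` separates the two ultrafilters, so the parts are disjoint, and no part is empty.
  have key : ∀ g g' X, X ∈ g → X ∉ g' → φ g ≠ φ g' := by
    intro g g' X hX hX' h
    have := disjoint_gleasonPart_of_mem hp1 hz (hU g) (hlim g) (hU g') (hlim g')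
      ((hUA g X).1 hX) ((hUA g' X).2 hX')
    rw [h] at this
    exact Set.disjoint_left.1 this (mem_gleasonPart_self _) (mem_gleasonPart_self _)
  have hinj : Function.Injective
      fun g => (⟨φ g, hφ g⟩ : wstarAcc (deltaSeq hp z hz.le)) := by
    intro g g' h
    have h' : φ g = φ g' := congrArg Subtype.val h
    ext X
    by_contra hX
    rw [not_iff] at hX
    by_cases hg : X ∈ g
    · exact key g g' X hg (fun hg' => (hX.2 hg') hg) h'
    · exact key g' g X (hX.1 hg) hg h'.symm
  have hcard : #(Set (Set ℕ)) = 2 ^ 𝔠 := by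
    rw [mk_set, mk_set, mk_nat, two_power_aleph0]
  exact hcard.symm.trans_le (mk_le_of_injective hinj)

/-- Parts are no more numerous than characters; conversely, disjointness makes `gleasonPart`
injective on the accumulation set. -/
theorem mk_gleasonParts_subset_fiber (hp1 : 1 < p) (hp : p ≠ ∞) (hz : ‖z‖ < 1) :
    #{G : Set (Spectrum (EllP p)) | G ∈ gleasonParts (EllP p) ∧
      G ⊆ fiber (NormedSpace.inclusionInDoubleDual ℂ (EllP p) z)} = 2 ^ 𝔠 := by
  refine le_antisymm ?_ ?_
  · refine (mk_le_mk_of_subset fun G hG => hG.1).trans (mk_range_le.trans ?_)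
    exact mk_spectrum_ellP_le hp
  · rw [← mk_wstarAcc_deltaSeq hp1 hp hz]
    refine mk_le_of_injective (f := fun φ => ⟨gleasonPart φ.1, ⟨φ.1, rfl⟩,
      gleasonPart_subset_fiber hp1 hp hz φ.2⟩) fun φ φ' h => ?_
    have h' : gleasonPart φ.1 = gleasonPart φ'.1 := congrArg Subtype.val h
    by_contra hne
    have hd := pairwiseDisjoint_gleasonPart hp1 hp hz φ.2 φ'.2 fun e => hne (Subtype.ext e)
    rw [Function.onFun, h'] at hd
    exact Set.disjoint_left.1 hd (mem_gleasonPart_self _) (mem_gleasonPart_self _)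

end Cardinality

end HolSpectrum

end

theorem mainTheorem1 (p : ℝ≥0∞) [Fact (1 ≤ p)] (hp1 : 1 < p) (hp : p ≠ ∞)
    (z : HolSpectrum.EllP p) (hz : ‖z‖ < 1) :
    #(HolSpectrum.wstarAcc (HolSpectrum.deltaSeq hp z hz.le)) = 2 ^ 𝔠 ∧
    HolSpectrum.wstarAcc (HolSpectrum.deltaSeq hp z hz.le) ⊆
      HolSpectrum.fiber (NormedSpace.inclusionInDoubleDual ℂ (HolSpectrum.EllP p) z) ∧
    (HolSpectrum.wstarAcc (HolSpectrum.deltaSeq hp z hz.le)).PairwiseDisjoint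
      HolSpectrum.gleasonPart ∧
    (∀ φ ∈ HolSpectrum.wstarAcc (HolSpectrum.deltaSeq hp z hz.le),
      HolSpectrum.gleasonPart φ ⊆
        HolSpectrum.fiber (NormedSpace.inclusionInDoubleDual ℂ (HolSpectrum.EllP p) z)) ∧
    #{G : Set (HolSpectrum.Spectrum (HolSpectrum.EllP p)) |
      G ∈ HolSpectrum.gleasonParts (HolSpectrum.EllP p) ∧
      G ⊆ HolSpectrum.fiber (NormedSpace.inclusionInDoubleDual ℂ (HolSpectrum.EllP p) z)}
      = 2 ^ 𝔠 :=
  ⟨HolSpectrum.mk_wstarAcc_deltaSeq hp1 hp hz,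
    fun _ hφ => HolSpectrum.gleasonPart_subset_fiber hp1 hp hz hφ
      (HolSpectrum.mem_gleasonPart_self _),
    HolSpectrum.pairwiseDisjoint_gleasonPart hp1 hp hz,
    fun _ hφ => HolSpectrum.gleasonPart_subset_fiber hp1 hp hz hφ,
    HolSpectrum.mk_gleasonParts_subset_fiber hp1 hp hz⟩
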